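/- **Theorem (symmetric private-coin uniformity testing).** Consider $n$ users, each holding $m$ i.i.d. samples from the same unknown probability distribution $p$ on $\{1,\dots,k\}$. In a *symmetric, private-coin protocol with $b$ bits per user*, every user applies the same randomized map, using its own independent randomness and no shared seed, to its $m$ samples and sends the resulting $b$-bit message to a server, which outputs *accept* or *reject* as a function of the $n$ messages. Such a protocol *tests uniformity with distance parameter $\alpha$* if, for every $p$, it accepts with probability at least $2/3$ when $p$ is the uniform distribution $u_k$ on $\{1,\dots,k\}$, and rejects with probability at least $2/3$ when $d_{\mathrm{TV}}(p,u_k)>\alpha$, where $d_{\mathrm{TV}}(p,q)=\frac12\sum_x|p(x)-q(x)|$. There exist absolute constants $C,B>0$ such that, for all integers $k,m\ge 1$, every $\alpha\in(0,1]$ and every integer $$ n \;\ge\; C\left(\frac{k^{3/2}\log k}{m\,\alpha^2}\vee k\right), $$ there is a symmetric, private-coin protocol with $n$ users, each holding $m$ samples and sending at most $B\log k$ bits, that tests uniformity with distance parameter $\alpha$. (There is no privacy requirement. In particular $n=O\!\left(\frac{k^{3/2}\log k}{m\alpha^2}\vee k\right)$ users suffice.) -/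

import Mathlib

open MeasureTheory ProbabilityTheory

noncomputable section

/-- Total variation distance between two probability distributions on `{0, …, k - 1}`. -/
def tvDist {k : ℕ} (p q : PMF (Fin k)) : ℝ :=
  (1 / 2) * ∑ x, |(p x).toReal - (q x).toReal|

/-- The law of `m` independent samples from `p`, i.e. the product measure `p^{⊗ m}`. -/
def sampleLaw {k : ℕ} (m : ℕ) (p : PMF (Fin k)) : Measure (Fin m → Fin k) :=
  Measure.pi fun _ => p.toMeasure

/-- A symmetric, private-coin, non-interactive protocol with `n` users, each holding `m` samples
from a domain of size `k` and sending one message of `b` bits to a server.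

* Symmetric: there is one randomizer, which every user runs.
* Private-coin: a randomizer is a Markov kernel from the user's own samples to messages; its
  randomness is drawn afresh by each user, and there is no shared seed.

The server's decision (`true` means accept) is a deterministic function of the `n` messages. -/
structure SymmetricPrivateCoinProtocol (k m n b : ℕ) where
  randomizer : Kernel (Fin m → Fin k) (Fin b → Bool)
  isMarkovKernel : IsMarkovKernel randomizer
  decision : (Fin n → Fin b → Bool) → Bool

namespace SymmetricPrivateCoinProtocol

variable {k m n b : ℕ}

/-- The law of the message of one user, whose `m` samples are drawn independently from `p`. -/
def messageLaw (P : SymmetricPrivateCoinProtocol k m n b) (p : PMF (Fin k)) :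
    Measure (Fin b → Bool) :=
  (sampleLaw m p).bind P.randomizer

/-- The joint law of the `n` messages that the server receives. The users' samples and coins are
independent, so the messages are independent and identically distributed. -/
def transcriptLaw (P : SymmetricPrivateCoinProtocol k m n b) (p : PMF (Fin k)) :
    Measure (Fin n → Fin b → Bool) :=
  Measure.pi fun _ => P.messageLaw p

/-- The protocol tests uniformity with distance parameter `α`: whatever the unknown distribution
`p` is, it accepts with probability at least `2/3` if `p` is uniform, and it rejects with
probability at least `2/3` if `p` is at total variation distance more than `α` from uniform. -/
def TestsUniformity [NeZero k] (P : SymmetricPrivateCoinProtocol k m n b) (α : ℝ) : Prop :=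
  ∀ p : PMF (Fin k),
    (tvDist p (PMF.uniformOfFintype (Fin k)) = 0 →
      2 / 3 ≤ (P.transcriptLaw p).real {y | P.decision y = true}) ∧
    (α < tvDist p (PMF.uniformOfFintype (Fin k)) →
      2 / 3 ≤ (P.transcriptLaw p).real {y | P.decision y = false})

end SymmetricPrivateCoinProtocol

end

/-! The server sums a symmetric kernel `h` over all pairs of messages with one user in each half.
Under uniformity `h` is centred, so only its second moment enters the variance; far from uniformity
its mean dominates the fluctuations. Chebyshev's inequality handles both cases
(`exists_testsUniformity_of_kernel`).

If m ≤ k, one sample per user and the centred collision kernel suffice: n of order √k/α² + k is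
enough, and √k ≤ k^{3/2}/m.

If m ≥ k, a user picks a random coordinate i and reports its count, rounded with a random shift at
scale s ≈ √(m/k), the size of the count's fluctuations under uniformity, and clipped to 32k + 1
values. The random shift removes the rounding bias: the mean report has slope about m/s in p i
wherever clipping is rare. So it moves by some β i with |β i| ≳ min(|m p i − m/k|/s, k)
(`min_le_abs_quantE_sub`), while its second moment is O(1 + β i²) (`quantE_sq_sub_le`). Multiplying
centred reports on a common coordinate gives a kernel of mean Q/k², Q = ∑ β i². Since Q ≥ min(m α²,
4k²) (`le_sum_meanShift_sq`), the signal wins once nQ ≳ k^{3/2} and n ≳ k. The factor log k in the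
bound on n is slack. -/

/-! ### Two-sample statistics and Chebyshev's inequality -/

section TwoSample

variable {Y : Type*} [Finite Y] [MeasurableSpace Y] [MeasurableSingletonClass Y]
  (ν : Measure Y) [IsProbabilityMeasure ν]

/-- Second moment about `c` of a sum of i.i.d. variables on a finite space. -/
theorem integral_sq_sum_pi_sub {ι : Type*} [Fintype ι] (f : Y → ℝ) (c : ℝ) :
    ∫ x, ((∑ a, f (x a)) - c) ^ 2 ∂(Measure.pi fun _ : ι => ν) =
      Fintype.card ι * (∫ y, f y ^ 2 ∂ν - (∫ y, f y ∂ν) ^ 2) +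
        (Fintype.card ι * ∫ y, f y ∂ν - c) ^ 2 := by
  set μ := Measure.pi fun _ : ι => ν
  have hmean : ∫ x, ∑ a, f (x a) ∂μ = Fintype.card ι * ∫ y, f y ∂ν := by
    rw [integral_finsetSum _ fun _ _ => Integrable.of_finite]
    have : ∀ a : ι, ∫ x, f (x a) ∂μ = ∫ y, f y ∂ν := fun a =>
      integral_comp_eval (μ := fun _ : ι => ν) (i := a) (f := f)
        (Integrable.of_finite).aestronglyMeasurable
    simp [this]
  have hvar : Var[fun x => ∑ a, f (x a); μ] =
      Fintype.card ι * (∫ y, f y ^ 2 ∂ν - (∫ y, f y ∂ν) ^ 2) := by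
    have h := variance_sum_pi (μ := fun _ : ι => ν) (X := fun _ => f) fun _ => MemLp.of_discrete
    have e : (∑ i : ι, fun ω : ι → Y => f (ω i)) = fun x => ∑ a, f (x a) := by
      ext; simp
    rw [e] at h
    rw [h, variance_eq_sub MemLp.of_discrete]
    simp [mul_sub]
  rw [variance_eq_sub MemLp.of_discrete, hmean] at hvar
  have : ∀ x : ι → Y, ((∑ a, f (x a)) - c) ^ 2 =
      (∑ a, f (x a)) ^ 2 - 2 * c * (∑ a, f (x a)) + c ^ 2 := fun x => by ring
  simp_rw [this]
  rw [integral_add Integrable.of_finite Integrable.of_finite,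
    integral_sub Integrable.of_finite Integrable.of_finite, integral_const_mul, hmean]
  simp only [Pi.pow_apply] at hvar
  simp only [integral_const, probReal_univ, smul_eq_mul, one_mul]
  linarith

/-- Variance bound for the two-sample statistic `∑ a, ∑ b, h (x a) (y b)`. -/
theorem integral_sq_two_sample_sub_le {ι κ : Type*} [Fintype ι] [Fintype κ] (h : Y → Y → ℝ)
    (hsymm : ∀ x y, h x y = h y x) :
    ∫ z, ((∑ a, ∑ b, h (z.1 a) (z.2 b)) -
        Fintype.card ι * Fintype.card κ * ∫ x, ∫ y, h x y ∂ν ∂ν) ^ 2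
        ∂((Measure.pi fun _ : ι => ν).prod (Measure.pi fun _ : κ => ν)) ≤
      Fintype.card ι * Fintype.card κ * (∫ x, ∫ y, h x y ^ 2 ∂ν ∂ν +
        (Fintype.card ι + Fintype.card κ) * ∫ x, (∫ y, h x y ∂ν) ^ 2 ∂ν) := by
  set N := (Fintype.card ι : ℝ)
  set K := (Fintype.card κ : ℝ)
  have hN : 0 ≤ N := Nat.cast_nonneg _
  have hK : 0 ≤ K := Nat.cast_nonneg _
  set θ := ∫ x, ∫ y, h x y ∂ν ∂ν
  set g : Y → ℝ := fun x => ∫ y, h x y ∂ν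
  set A := ∫ x, ∫ y, h x y ^ 2 ∂ν ∂ν
  set D := ∫ x, g x ^ 2 ∂ν
  have hθ : ∫ x, g x ∂ν = θ := rfl
  have hg : ∀ y, ∫ x, h x y ∂ν = g y := fun y => by simp_rw [hsymm _ y]; rfl
  rw [integral_prod _ Integrable.of_finite]
  -- Conditionally on the first sample, the statistic is an i.i.d. sum over the second. The negative
  -- square in its variance is dropped.
  have hinner : ∀ x : ι → Y,
      ∫ y, ((∑ a, ∑ b, h (x a) (y b)) - N * K * θ) ^ 2 ∂(Measure.pi fun _ : κ => ν) ≤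
        K * ∫ z, ((∑ a, h (x a) z) - 0) ^ 2 ∂ν + K ^ 2 * ((∑ a, g (x a)) - N * θ) ^ 2 := by
    intro x
    have e : ∀ y : κ → Y, (∑ a, ∑ b, h (x a) (y b)) = ∑ b, ∑ a, h (x a) (y b) :=
      fun y => Finset.sum_comm
    simp_rw [e]
    rw [integral_sq_sum_pi_sub ν (fun z => ∑ a, h (x a) z)]
    have e2 : ∫ z, ∑ a, h (x a) z ∂ν = ∑ a, g (x a) :=
      integral_finsetSum _ fun _ _ => Integrable.of_finite
    rw [e2]
    simp only [sub_zero]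
    nlinarith [mul_nonneg hK (sq_nonneg (∑ a, g (x a)))]
  refine (integral_mono Integrable.of_finite Integrable.of_finite hinner).trans ?_
  rw [integral_add Integrable.of_finite Integrable.of_finite, integral_const_mul,
    integral_const_mul, integral_sq_sum_pi_sub ν g, hθ, integral_integral_swap Integrable.of_finite]
  have hswap : ∀ z, ∫ x : ι → Y, ((∑ a, h (x a) z) - 0) ^ 2 ∂(Measure.pi fun _ : ι => ν) =
      N * (∫ x, h x z ^ 2 ∂ν - g z ^ 2) + (N * g z - 0) ^ 2 := fun z => by
    rw [integral_sq_sum_pi_sub ν (fun w => h w z), hg]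
  simp only [hswap]
  have hA : ∫ y, ∫ x, h x y ^ 2 ∂ν ∂ν = A :=
    congrArg (fun f => ∫ y, f y ∂ν) (funext fun y => congrArg (fun f => ∫ x, f x ∂ν)
      (funext fun x => by rw [hsymm]))
  have h1 : ∫ y, (N * (∫ x, h x y ^ 2 ∂ν - g y ^ 2) + (N * g y - 0) ^ 2) ∂ν ≤ N * A + N ^ 2 * D := by
    rw [← hA, ← integral_const_mul, ← integral_const_mul,
      ← integral_add Integrable.of_finite Integrable.of_finite]
    refine integral_mono Integrable.of_finite Integrable.of_finite fun y => ?_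
    simp only
    nlinarith [mul_nonneg hN (sq_nonneg (g y))]
  have h2 := mul_le_mul_of_nonneg_left h1 hK
  have h3 : 0 ≤ K ^ 2 * (N * θ ^ 2) := by positivity
  nlinarith

variable {n : ℕ} (h : Y → Y → ℝ)

/-- The cross statistic: the sum of `h` over all pairs consisting of one user from the first half
and one from the second. -/
noncomputable def crossStat (n : ℕ) (h : Y → Y → ℝ) (y : Fin n → Y) : ℝ :=
  ∑ a : {i : Fin n // i.val < n / 2}, ∑ b : {i : Fin n // ¬ i.val < n / 2}, h (y a) (y b)

/-- Number of pairs in the cross statistic. -/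
noncomputable def crossCount (n : ℕ) : ℝ :=
  Fintype.card {i : Fin n // i.val < n / 2} * Fintype.card {i : Fin n // ¬ i.val < n / 2}

theorem card_first_half (n : ℕ) : Fintype.card {i : Fin n // i.val < n / 2} = n / 2 := by
  rw [Fintype.card_subtype, Fin.card_filter_val_lt]
  omega

theorem card_second_half (n : ℕ) :
    Fintype.card {i : Fin n // ¬ i.val < n / 2} = n - n / 2 := by
  rw [Fintype.card_subtype_compl, card_first_half, Fintype.card_fin]

/-- Each half holds at least n/3 users; n = 3 is the extreme case. -/
theorem sq_div_nine_le_crossCount (hn : 2 ≤ n) : (n : ℝ) ^ 2 / 9 ≤ crossCount n := by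
  rw [crossCount, card_first_half, card_second_half]
  have h1 : (n : ℝ) / 3 ≤ ((n / 2 : ℕ) : ℝ) := by
    rw [div_le_iff₀ (by norm_num)]
    exact_mod_cast (by omega : n ≤ n / 2 * 3)
  have h2 : (n : ℝ) / 3 ≤ ((n - n / 2 : ℕ) : ℝ) := by
    rw [div_le_iff₀ (by norm_num)]
    exact_mod_cast (by omega : n ≤ (n - n / 2) * 3)
  calc (n : ℝ) ^ 2 / 9 = n / 3 * (n / 3) := by ring
    _ ≤ _ := mul_le_mul h1 h2 (by positivity) (by positivity)

theorem integral_sq_crossStat_sub_le (hsymm : ∀ x y, h x y = h y x) :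
    ∫ y, (crossStat n h y - crossCount n * ∫ x, ∫ y, h x y ∂ν ∂ν) ^ 2
        ∂(Measure.pi fun _ : Fin n => ν) ≤
      crossCount n * (∫ x, ∫ y, h x y ^ 2 ∂ν ∂ν + n * ∫ x, (∫ y, h x y ∂ν) ^ 2 ∂ν) := by
  have key := integral_sq_two_sample_sub_le ν (ι := {i : Fin n // i.val < n / 2})
    (κ := {i : Fin n // ¬ i.val < n / 2}) h hsymm
  have mp := measurePreserving_piEquivPiSubtypeProd (fun _ : Fin n => ν)
    (fun i : Fin n => i.val < n / 2)
  rw [← mp.integral_comp'] at key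
  have hc : (Fintype.card {i : Fin n // i.val < n / 2} : ℝ) +
      Fintype.card {i : Fin n // ¬ i.val < n / 2} = n := by
    rw [card_first_half, card_second_half]
    exact_mod_cast (by omega : n / 2 + (n - n / 2) = n)
  rw [hc] at key
  exact key

/-- Chebyshev's inequality for the cross statistic. -/
theorem measureReal_crossStat_far_le (hsymm : ∀ x y, h x y = h y x) (ε : ℝ) :
    ε ^ 2 * (Measure.pi fun _ : Fin n => ν).real
        {y | ε ^ 2 ≤ (crossStat n h y - crossCount n * ∫ x, ∫ y, h x y ∂ν ∂ν) ^ 2} ≤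
      crossCount n * (∫ x, ∫ y, h x y ^ 2 ∂ν ∂ν + n * ∫ x, (∫ y, h x y ∂ν) ^ 2 ∂ν) :=
  (mul_meas_ge_le_integral_of_nonneg (Filter.Eventually.of_forall fun _ => sq_nonneg _)
    Integrable.of_finite _).trans (integral_sq_crossStat_sub_le ν h hsymm)

theorem two_thirds_le_of_compl_subset {Ω : Type*} [MeasurableSpace Ω] {μ : Measure Ω}
    [IsProbabilityMeasure μ] {s t : Set Ω} (hs : MeasurableSet s) (hst : sᶜ ⊆ t)
    (ht : μ.real t ≤ 1 / 3) : 2 / 3 ≤ μ.real s := by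
  have h1 := measureReal_mono (μ := μ) hst
  rw [probReal_compl_eq_one_sub hs] at h1
  linarith

/-- The cross statistic stays below the threshold when the kernel is centred. -/
theorem two_thirds_le_crossStat_lt (hn : 2 ≤ n) (hsymm : ∀ x y, h x y = h y x) {t : ℝ}
    (ht : 0 < t) (hcentred : ∀ x, ∫ y, h x y ∂ν = 0)
    (hA : ∫ x, ∫ y, h x y ^ 2 ∂ν ∂ν ≤ n ^ 2 * t ^ 2 / 27) :
    2 / 3 ≤ (Measure.pi fun _ : Fin n => ν).real {y | crossStat n h y < crossCount n * t} := by
  have hN : 0 < (n : ℝ) ^ 2 / 9 := by positivity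
  have hc := sq_div_nine_le_crossCount hn
  have hc0 : 0 < crossCount n := hN.trans_le hc
  have key := measureReal_crossStat_far_le ν (n := n) h hsymm (crossCount n * t)
  simp only [hcentred, integral_zero, mul_zero, sub_zero, ne_eq, OfNat.ofNat_ne_zero,
    not_false_eq_true, zero_pow, add_zero] at key
  refine two_thirds_le_of_compl_subset (MeasurableSet.of_discrete) (t :=
    {y | (crossCount n * t) ^ 2 ≤ crossStat n h y ^ 2}) ?_ ?_
  · intro y hy
    simp only [Set.mem_compl_iff, Set.mem_ofPred_eq, not_lt] at hy ⊢
    exact pow_le_pow_left₀ (by positivity) hy 2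
  · set P := (Measure.pi fun _ : Fin n => ν).real
      {y | (crossCount n * t) ^ 2 ≤ crossStat n h y ^ 2}
    -- The 27 is 9 · 3: one factor from `sq_div_nine_le_crossCount`, one from the error probability
    -- 1/3.
    have h1 : crossCount n * t ^ 2 * P ≤ n ^ 2 * t ^ 2 / 27 := by
      refine le_trans ?_ hA
      refine le_of_mul_le_mul_left ?_ hc0
      calc _ = (crossCount n * t) ^ 2 * P := by ring
        _ ≤ _ := key
    have h2 : (n : ℝ) ^ 2 / 9 * t ^ 2 * P ≤ crossCount n * t ^ 2 * P := by
      gcongr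
    have h3 : 0 < (n : ℝ) ^ 2 * t ^ 2 := by positivity
    refine le_of_mul_le_mul_left ?_ h3
    linarith

/-- The cross statistic exceeds the threshold when the kernel has a large mean. -/
theorem two_thirds_le_crossStat_ge (hn : 2 ≤ n) (hsymm : ∀ x y, h x y = h y x) {t θ : ℝ}
    (hθ0 : 0 < θ) (hθ : ∫ x, ∫ y, h x y ∂ν ∂ν = θ) (ht : 2 * t ≤ θ)
    (hV : ∫ x, ∫ y, h x y ^ 2 ∂ν ∂ν + n * ∫ x, (∫ y, h x y ∂ν) ^ 2 ∂ν ≤ n ^ 2 * θ ^ 2 / 108) :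
    2 / 3 ≤ (Measure.pi fun _ : Fin n => ν).real {y | ¬ crossStat n h y < crossCount n * t} := by
  have hN : 0 < (n : ℝ) ^ 2 / 9 := by positivity
  have hc := sq_div_nine_le_crossCount hn
  have hc0 : 0 < crossCount n := hN.trans_le hc
  -- As t ≤ θ/2, an error forces a deviation of half the mean; this turns 27 into 108 = 4 · 27.
  have key := measureReal_crossStat_far_le ν (n := n) h hsymm (crossCount n * (θ / 2))
  rw [hθ] at key
  refine two_thirds_le_of_compl_subset (MeasurableSet.of_discrete) (t :=
    {y | (crossCount n * (θ / 2)) ^ 2 ≤ (crossStat n h y - crossCount n * θ) ^ 2}) ?_ ?_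
  · intro y hy
    simp only [Set.mem_compl_iff, Set.mem_ofPred_eq, not_not] at hy ⊢
    have : crossCount n * t ≤ crossCount n * (θ / 2) := by gcongr; linarith
    rw [← neg_sub, neg_sq]
    exact pow_le_pow_left₀ (by positivity) (by linarith) 2
  · set P := (Measure.pi fun _ : Fin n => ν).real
      {y | (crossCount n * (θ / 2)) ^ 2 ≤ (crossStat n h y - crossCount n * θ) ^ 2}
    have h1 : crossCount n * (θ / 2) ^ 2 * P ≤ n ^ 2 * θ ^ 2 / 108 := by
      refine le_trans ?_ hV
      refine le_of_mul_le_mul_left ?_ hc0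
      calc _ = (crossCount n * (θ / 2)) ^ 2 * P := by ring
        _ ≤ _ := key
    have h2 : (n : ℝ) ^ 2 / 9 * (θ / 2) ^ 2 * P ≤ crossCount n * (θ / 2) ^ 2 * P := by
      gcongr
    have h3 : 0 < (n : ℝ) ^ 2 * θ ^ 2 := by positivity
    refine le_of_mul_le_mul_left ?_ h3
    linarith

end TwoSample

/-! ### Protocols driven by a uniform private seed -/

instance sampleLaw.instIsProbabilityMeasure {k m : ℕ} (p : PMF (Fin k)) :
    IsProbabilityMeasure (sampleLaw m p) := by
  unfold sampleLaw; infer_instance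

/-- Mean of `φ` of one user's message, when the user applies `F` to the samples and to a uniformly
random private seed. -/
noncomputable def seededMean {k m : ℕ} {R W : Type*} [Fintype R] (F : (Fin m → Fin k) → R → W)
    (p : PMF (Fin k)) (φ : W → ℝ) : ℝ :=
  ∫ x, (∑ r, φ (F x r)) / Fintype.card R ∂sampleLaw m p

namespace SymmetricPrivateCoinProtocol

/-- The protocol in which a user applies `F` to the samples and to a uniformly random private seed,
and sends the encoded result. -/
noncomputable def ofSeed {k m b : ℕ} {R W : Type} [Fintype R] [Nonempty R] (n : ℕ)
    (F : (Fin m → Fin k) → R → W) (enc : W → Fin b → Bool) (D : (Fin n → Fin b → Bool) → Bool) :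
    SymmetricPrivateCoinProtocol k m n b where
  randomizer := ⟨fun x => ((PMF.uniformOfFintype R).map fun r => enc (F x r)).toMeasure,
    Measurable.of_discrete⟩
  isMarkovKernel := ⟨fun _ => PMF.toMeasure.isProbabilityMeasure _⟩
  decision := D

variable {k m n b : ℕ}

instance (P : SymmetricPrivateCoinProtocol k m n b) (p : PMF (Fin k)) :
    IsProbabilityMeasure (P.messageLaw p) := by
  have := P.isMarkovKernel
  unfold messageLaw; infer_instance

/-- Replaces the randomizer's kernel by a plain average over samples and seeds, the only form in
which message laws are used below. -/
theorem integral_messageLaw_ofSeed {R W : Type} [Fintype R] [Nonempty R]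
    (F : (Fin m → Fin k) → R → W) (enc : W → Fin b → Bool) (D : (Fin n → Fin b → Bool) → Bool)
    (p : PMF (Fin k)) (φ : (Fin b → Bool) → ℝ) :
    ∫ y, φ y ∂(ofSeed n F enc D).messageLaw p = seededMean F p fun w => φ (enc w) := by
  classical
  have := (ofSeed n F enc D).isMarkovKernel
  rw [messageLaw, Measure.comp_eq_comp_const_apply, Kernel.integral_comp Integrable.of_finite,
    Kernel.const_apply, seededMean]
  congr 1
  funext x
  let _ : MeasurableSpace R := ⊤
  have : DiscreteMeasurableSpace R := ⟨fun _ => trivial⟩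
  change ∫ y, φ y ∂((PMF.uniformOfFintype R).map fun r => enc (F x r)).toMeasure = _
  rw [← PMF.toMeasure_map _ _ Measurable.of_discrete,
    integral_map Measurable.of_discrete.aemeasurable Integrable.of_finite.aestronglyMeasurable,
    PMF.integral_eq_sum]
  simp [PMF.uniformOfFintype_apply, ← Finset.mul_sum, div_eq_inv_mul]

end SymmetricPrivateCoinProtocol

theorem tvDist_eq_zero_iff {k : ℕ} {p q : PMF (Fin k)} : tvDist p q = 0 ↔ p = q := by
  refine ⟨fun h => ?_, fun h => by simp [tvDist, h]⟩
  have h0 : ∑ x, |(p x).toReal - (q x).toReal| = 0 := by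
    unfold tvDist at h; linarith
  rw [Finset.sum_eq_zero_iff_of_nonneg fun _ _ => abs_nonneg _] at h0
  ext x
  have := h0 x (Finset.mem_univ x)
  rw [abs_eq_zero, sub_eq_zero] at this
  exact (ENNReal.toReal_eq_toReal_iff' (p.apply_ne_top x) (q.apply_ne_top x)).1 this

/-- A symmetric kernel on messages that is centred under uniformity and has a large mean far from
uniformity gives a uniformity test. -/
theorem exists_testsUniformity_of_kernel {k m n b : ℕ} [NeZero k] {R W : Type} [Fintype R]
    [Nonempty R] [Fintype W] [Nonempty W] (hW : Fintype.card W ≤ 2 ^ b) (hn : 2 ≤ n) {α t : ℝ}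
    (ht : 0 < t) (F : (Fin m → Fin k) → R → W) (h : W → W → ℝ) (hsymm : ∀ x y, h x y = h y x)
    (hcentred : ∀ w, seededMean F (PMF.uniformOfFintype (Fin k)) (h w) = 0)
    (hnull : seededMean F (PMF.uniformOfFintype (Fin k)) (fun w =>
      seededMean F (PMF.uniformOfFintype (Fin k)) fun w' => h w w' ^ 2) ≤ n ^ 2 * t ^ 2 / 27)
    (hfar : ∀ p : PMF (Fin k), α < tvDist p (PMF.uniformOfFintype (Fin k)) →
      2 * t ≤ seededMean F p (fun w => seededMean F p (h w)) ∧
      seededMean F p (fun w => seededMean F p fun w' => h w w' ^ 2) +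
        n * seededMean F p (fun w => seededMean F p (h w) ^ 2) ≤
        n ^ 2 * seededMean F p (fun w => seededMean F p (h w)) ^ 2 / 108) :
    ∃ P : SymmetricPrivateCoinProtocol k m n b, P.TestsUniformity α := by
  classical
  obtain ⟨enc⟩ : Nonempty (W ↪ (Fin b → Bool)) :=
    Function.Embedding.nonempty_of_card_le (by simpa using hW)
  -- Bit strings outside the range of `enc` decode to an arbitrary message; they are never sent.
  set dec := Function.invFun enc
  have hdec : ∀ w, dec (enc w) = w := Function.leftInverse_invFun enc.injective
  set H : (Fin b → Bool) → (Fin b → Bool) → ℝ := fun y y' => h (dec y) (dec y')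
  set P := SymmetricPrivateCoinProtocol.ofSeed n F enc
    fun y => decide (crossStat n H y < crossCount n * t)
  have hP : ∀ y, P.decision y = decide (crossStat n H y < crossCount n * t) := fun _ => rfl
  have hI : ∀ p (φ : (Fin b → Bool) → ℝ), ∫ y, φ y ∂P.messageLaw p =
      seededMean F p fun w => φ (enc w) :=
    SymmetricPrivateCoinProtocol.integral_messageLaw_ofSeed F enc _
  refine ⟨P, fun p => ⟨fun hp => ?_, fun hp => ?_⟩⟩
  · rw [tvDist_eq_zero_iff] at hp
    subst hp
    simp only [hP, decide_eq_true_eq]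
    refine two_thirds_le_crossStat_lt _ H hn (fun _ _ => hsymm _ _) ht ?_ ?_
    · intro y
      simp only [hI, H, hdec, hcentred]
    · simpa only [hI, H, hdec] using hnull
  · obtain ⟨h1, h2⟩ := hfar p hp
    simp only [hP, decide_eq_false_iff_not]
    refine two_thirds_le_crossStat_ge _ H hn (fun _ _ => hsymm _ _)
      (lt_of_lt_of_le (by linarith) h1) ?_ h1 ?_
    · simp only [hI, H, hdec]
    · simpa only [hI, H, hdec] using h2

/-! ### Point masses and ℓ² distance from uniform -/

section Masses

variable {k : ℕ} (p : PMF (Fin k))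

theorem PMF.sum_toReal_eq_one {α : Type*} [Fintype α] (p : PMF α) : ∑ x, (p x).toReal = 1 := by
  rw [← ENNReal.toReal_sum fun x _ => p.apply_ne_top x, ← tsum_fintype (L := .unconditional α),
    p.tsum_coe, ENNReal.toReal_one]

theorem PMF.toReal_apply_le_one {α : Type*} (p : PMF α) (x : α) : (p x).toReal ≤ 1 :=
  ENNReal.toReal_le_of_le_ofReal zero_le_one (by simpa using p.coe_le_one x)

theorem toReal_uniformOfFintype_fin [NeZero k] (x : Fin k) :
    (PMF.uniformOfFintype (Fin k) x).toReal = 1 / k := by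
  simp

/-- A distribution far from uniform in total variation is far from uniform in `ℓ²`. -/
theorem sum_sq_sub_of_lt_tvDist [NeZero k] {α : ℝ} (hα : 0 < α)
    (h : α < tvDist p (PMF.uniformOfFintype (Fin k))) :
    4 * α ^ 2 ≤ k * ∑ x, ((p x).toReal - 1 / k) ^ 2 := by
  unfold tvDist at h
  simp only [toReal_uniformOfFintype_fin] at h
  have h1 : 2 * α ≤ ∑ x, |(p x).toReal - 1 / k| := by linarith
  have h2 := sq_sum_le_card_mul_sum_sq (s := Finset.univ)
    (f := fun x => |(p x).toReal - 1 / (k : ℝ)|)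
  simp only [sq_abs, Finset.card_univ, Fintype.card_fin] at h2
  calc 4 * α ^ 2 = (2 * α) ^ 2 := by ring
    _ ≤ _ := pow_le_pow_left₀ (by positivity) h1 2
    _ ≤ _ := h2

end Masses

/-! ### One sample per user: the collision kernel -/

theorem seededMean_eval {k m : ℕ} (i : Fin m) (p : PMF (Fin k)) (φ : Fin k → ℝ) :
    seededMean (fun x (_ : Unit) => x i) p φ = ∑ x, (p x).toReal * φ x := by
  have h := integral_comp_eval (μ := fun _ : Fin m => p.toMeasure) (i := i) (f := φ)
    (Integrable.of_finite).aestronglyMeasurable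
  simp only [seededMean, sampleLaw, Finset.univ_unique, Finset.sum_const, Finset.card_singleton,
    Fintype.card_unit, one_smul, Nat.cast_one, div_one]
  rw [h, PMF.integral_eq_sum]
  simp

section Collision

variable {k : ℕ} (q : Fin k → ℝ) (hq : ∑ x, q x = 1)

/-- The centred collision kernel. -/
noncomputable def collisionKernel (k : ℕ) (x y : Fin k) : ℝ := (if x = y then 1 else 0) - 1 / k

theorem collisionKernel_comm (x y : Fin k) : collisionKernel k x y = collisionKernel k y x := by
  simp [collisionKernel, eq_comm]

include hq

theorem sum_mul_collisionKernel (w : Fin k) :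
    ∑ x, q x * collisionKernel k w x = q w - 1 / k := by
  simp only [collisionKernel, mul_sub, Finset.sum_sub_distrib, ← Finset.sum_mul, hq]
  simp

theorem sum_sq_sub_inv [NeZero k] : ∑ x, (q x - 1 / k) ^ 2 = ∑ x, q x ^ 2 - 1 / k := by
  have hk : (k : ℝ) ≠ 0 := NeZero.ne _
  have : ∀ x, (q x - 1 / (k : ℝ)) ^ 2 = q x ^ 2 - 2 / k * q x + 1 / k ^ 2 := fun x => by
    field_simp; ring
  simp only [this, Finset.sum_add_distrib, Finset.sum_sub_distrib, ← Finset.mul_sum, hq,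
    Finset.sum_const, Finset.card_univ, Fintype.card_fin, nsmul_eq_mul]
  field_simp; ring

/-- The deviations q x − 1/k sum to zero, so the mean of the collision kernel is exactly the squared
ℓ² distance from uniform. -/
theorem sum_mul_sub_inv [NeZero k] :
    ∑ x, q x * (q x - 1 / k) = ∑ x, (q x - 1 / k) ^ 2 := by
  rw [sum_sq_sub_inv q hq]
  simp only [mul_sub, Finset.sum_sub_distrib, ← Finset.sum_mul, hq]
  simp [sq]

theorem sum_mul_collisionKernel_sq_le [NeZero k] :
    ∑ w, q w * ∑ x, q x * collisionKernel k w x ^ 2 ≤ ∑ x, (q x - 1 / k) ^ 2 + 2 / k := by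
  have hk : (1 : ℝ) ≤ k := by exact_mod_cast NeZero.one_le
  have hin : ∀ w, ∑ x, q x * collisionKernel k w x ^ 2 = q w * (1 - 2 / k) + 1 / k ^ 2 := by
    intro w
    have : ∀ x, q x * collisionKernel k w x ^ 2 =
        (if w = x then q x * (1 - 2 / k) else 0) + q x * (1 / k ^ 2) := fun x => by
      unfold collisionKernel
      split_ifs <;> field_simp <;> ring
    simp only [this, Finset.sum_add_distrib, ← Finset.sum_mul, hq]
    simp
  have : ∀ w, q w * (q w * (1 - 2 / (k : ℝ)) + 1 / k ^ 2) =
    q w ^ 2 * (1 - 2 / k) + q w * (1 / k ^ 2) := fun w => by ring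
  simp only [hin, this, Finset.sum_add_distrib, ← Finset.sum_mul, hq]
  rw [sum_sq_sub_inv q hq]
  have h0 : 0 ≤ ∑ x, q x ^ 2 := Finset.sum_nonneg fun _ _ => sq_nonneg _
  have h1 : 1 / (k : ℝ) ^ 2 ≤ 1 / k := by
    apply one_div_le_one_div_of_le (by linarith); nlinarith
  have h2 : 0 ≤ (∑ x, q x ^ 2) * (2 / (k : ℝ)) := by positivity
  have h3 : 2 / (k : ℝ) = 1 / k + 1 / k := by ring
  nlinarith

omit hq in
-- No deviation exceeds the ℓ² norm r, so the weight q x is at most 1/k + r.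
theorem sum_mul_sub_sq_le [NeZero k] {r : ℝ} (hr : 0 ≤ r) (hr2 : ∑ x, (q x - 1 / k) ^ 2 = r ^ 2) :
    ∑ x, q x * (q x - 1 / k) ^ 2 ≤ r ^ 2 / k + r ^ 3 := by
  have h1 : ∀ x, q x - 1 / (k : ℝ) ≤ r := fun x => by
    refine le_of_sq_le_sq ?_ hr
    rw [← hr2]
    exact Finset.single_le_sum (f := fun x => (q x - 1 / (k : ℝ)) ^ 2)
      (fun _ _ => sq_nonneg _) (Finset.mem_univ x)
  calc ∑ x, q x * (q x - 1 / k) ^ 2 ≤ ∑ x, (1 / k + r) * (q x - 1 / k) ^ 2 := by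
        gcongr with x; linarith [h1 x]
    _ = _ := by rw [← Finset.mul_sum, hr2]; ring

end Collision

/-- Sending a single sample tests uniformity as soon as `n` is of order `√k / α² + k`. -/
theorem exists_testsUniformity_of_one_sample {k m n b : ℕ} [NeZero k] (hm : 1 ≤ m) (hb : k ≤ 2 ^ b)
    {α : ℝ} (hα : 0 < α) (hn : 1000 * (k : ℝ) ≤ n) (hnα : 1000 * √k ≤ n * α ^ 2) :
    ∃ P : SymmetricPrivateCoinProtocol k m n b, P.TestsUniformity α := by
  have hk : (1 : ℝ) ≤ k := by exact_mod_cast NeZero.one_le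
  set R := √(k : ℝ)
  have hRk : R ^ 2 = k := Real.sq_sqrt (by linarith)
  have hR : 1 ≤ R := Real.one_le_sqrt.2 hk
  have hn0 : (1000 : ℝ) ≤ n := by linarith
  have hn2 : 2 ≤ n := by
    have : (2 : ℝ) ≤ n := by linarith
    exact_mod_cast this
  -- With this threshold n²t²/27 = 3/k, above the null second moment bound 2/k, while the far mean
  -- is at least 1000/(n√k).
  have ht : 0 < 9 / ((n : ℝ) * R) := by positivity
  refine exists_testsUniformity_of_kernel (W := Fin k) (by simpa using hb) hn2 ht
    (fun x (_ : Unit) => x ⟨0, hm⟩) (collisionKernel k) collisionKernel_comm ?_ ?_ ?_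
  · intro w
    rw [seededMean_eval, sum_mul_collisionKernel _ (PMF.sum_toReal_eq_one _),
      toReal_uniformOfFintype_fin, sub_self]
  · simp only [seededMean_eval]
    refine (sum_mul_collisionKernel_sq_le _ (PMF.sum_toReal_eq_one _)).trans ?_
    simp only [toReal_uniformOfFintype_fin, sub_self]
    rw [← hRk]
    field_simp
    norm_num
  · intro p hp
    have hs := PMF.sum_toReal_eq_one p
    have hfar := sum_sq_sub_of_lt_tvDist p hα hp
    set q : Fin k → ℝ := fun x => (p x).toReal
    simp only [seededMean_eval]
    change _ ≤ ∑ w, q w * ∑ x, q x * _ ∧ (∑ w, q w * ∑ x, q x * _) +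
      n * (∑ w, q w * (∑ x, q x * _) ^ 2) ≤ n ^ 2 * (∑ w, q w * ∑ x, q x * _) ^ 2 / 108
    simp only [sum_mul_collisionKernel q hs, sum_mul_sub_inv q hs]
    have hA := sum_mul_collisionKernel_sq_le q hs
    set θ := ∑ x, (q x - 1 / (k : ℝ)) ^ 2 with hθdef
    have hθ0 : 0 ≤ θ := Finset.sum_nonneg fun _ _ => sq_nonneg _
    set r := √θ
    have hr : r ^ 2 = θ := Real.sq_sqrt hθ0
    have hr0 : 0 ≤ r := Real.sqrt_nonneg _
    have hB := sum_mul_sub_sq_le q hr0 (hθdef.symm.trans hr.symm)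
    change 4 * α ^ 2 ≤ k * θ at hfar
    have hθ : 1000 ≤ n * θ * R := by
      have h1 : 1000 * R ≤ (n * θ * R) * R := by
        calc 1000 * R ≤ n * α ^ 2 := hnα
          _ ≤ n * (k * θ) := by gcongr; nlinarith [sq_nonneg α]
          _ = _ := by rw [← hRk]; ring
      exact le_of_mul_le_mul_right h1 (by linarith)
    have hX : 0 ≤ n * θ := by positivity
    have hinv : 1 / R ≤ n * θ / 1000 := by
      rw [div_le_div_iff₀ (by linarith) (by norm_num)]; linarith
    have hnX : 1000000 ≤ n * (n * θ) := by
      have h1 : 1000 * R ≤ n := by nlinarith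
      calc (1000000 : ℝ) ≤ 1000 * (n * θ * R) := by linarith
        _ = 1000 * R * (n * θ) := by ring
        _ ≤ _ := by gcongr
    have hθX : 1000000 * θ ≤ (n * θ) ^ 2 := by nlinarith
    have hrX : r ≤ n * θ / 1000 := by
      refine le_of_sq_le_sq ?_ (by positivity)
      rw [hr]; linarith
    have hk1 : 1 / (k : ℝ) = (1 / R) ^ 2 := by rw [← hRk]; ring
    have hR1 : 1 / R ≤ 1 := by rw [div_le_one (by linarith)]; exact hR
    have hR0 : 0 ≤ 1 / R := by positivity
    refine ⟨?_, ?_⟩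
    · rw [← mul_div_assoc, div_le_iff₀ (by positivity)]
      linarith
    · have h2k : 2 / (k : ℝ) ≤ 2 * (n * θ / 1000) ^ 2 := by
        rw [show 2 / (k : ℝ) = 2 * (1 / k) by ring, hk1]; gcongr
      have h3 : n * (r ^ 2 / k) ≤ (n * θ) * (n * θ / 1000) := by
        calc n * (r ^ 2 / k) = n * θ * (1 / k) := by rw [hr]; ring
          _ ≤ _ := by
            refine mul_le_mul_of_nonneg_left ?_ hX
            rw [hk1]; nlinarith
      have h4 : n * r ^ 3 ≤ (n * θ) * (n * θ / 1000) := by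
        calc n * r ^ 3 = n * θ * r := by rw [← hr]; ring
          _ ≤ _ := by gcongr
      calc _ ≤ (θ + 2 / k) + n * (r ^ 2 / k + r ^ 3) := by gcongr
        _ ≤ _ := by linarith

/-! ### Binomial expectations -/

/-- Expectation of `φ` under the binomial distribution with `m` trials and success probability `q`. -/
noncomputable def binE : ℕ → ℝ → (ℕ → ℝ) → ℝ
  | 0, _, φ => φ 0
  | m + 1, q, φ => q * binE m q (fun N => φ (N + 1)) + (1 - q) * binE m q φ

section Binomial

variable (m : ℕ) (q : ℝ)

theorem binE_add (φ ψ : ℕ → ℝ) : binE m q (fun N => φ N + ψ N) = binE m q φ + binE m q ψ := by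
  induction m generalizing φ ψ with
  | zero => rfl
  | succ m ih => simp only [binE, ih]; ring

theorem binE_const_mul (c : ℝ) (φ : ℕ → ℝ) : binE m q (fun N => c * φ N) = c * binE m q φ := by
  induction m generalizing φ with
  | zero => rfl
  | succ m ih => simp only [binE, ih]; ring

theorem binE_const (c : ℝ) : binE m q (fun _ => c) = c := by
  induction m with
  | zero => rfl
  | succ m ih => simp only [binE, ih]; ring

theorem binE_sub (φ ψ : ℕ → ℝ) : binE m q (fun N => φ N - ψ N) = binE m q φ - binE m q ψ := by
  induction m generalizing φ ψ with
  | zero => rfl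
  | succ m ih => simp only [binE, ih]; ring

variable {q}

theorem binE_mono (h0 : 0 ≤ q) (h1 : q ≤ 1) {φ ψ : ℕ → ℝ} (h : ∀ N, φ N ≤ ψ N) :
    binE m q φ ≤ binE m q ψ := by
  induction m generalizing φ ψ with
  | zero => exact h 0
  | succ m ih =>
    exact add_le_add (mul_le_mul_of_nonneg_left (ih fun N => h _) h0)
      (mul_le_mul_of_nonneg_left (ih h) (by linarith))

theorem binE_nonneg (h0 : 0 ≤ q) (h1 : q ≤ 1) {φ : ℕ → ℝ} (h : ∀ N, 0 ≤ φ N) :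
    0 ≤ binE m q φ := by
  simpa [binE_const] using binE_mono m h0 h1 (φ := fun _ => 0) h

variable (q)

theorem binE_sq_sub (a : ℝ) :
    binE m q (fun N => ((N : ℝ) - a) ^ 2) = m * q * (1 - q) + (m * q - a) ^ 2 := by
  induction m generalizing a with
  | zero => simp [binE]
  | succ m ih =>
    have : (fun N : ℕ => (((N + 1 : ℕ) : ℝ) - a) ^ 2) =
        fun N : ℕ => ((N : ℝ) - (a - 1)) ^ 2 := by
      ext; push_cast; ring
    simp only [binE, this, ih]
    push_cast; ring

/-- Each of the m trials contributes the effect of flipping it, averaged over the other m − 1. For m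
= 0 the truncated `m - 1` is harmless, as the prefactor vanishes. -/
theorem hasDerivAt_binE (φ : ℕ → ℝ) :
    HasDerivAt (fun q => binE m q φ) (m * binE (m - 1) q fun N => φ (N + 1) - φ N) q := by
  induction m generalizing φ with
  | zero => simpa [binE] using hasDerivAt_const q (φ 0)
  | succ m ih =>
    have h := ((hasDerivAt_id q).mul (ih fun N => φ (N + 1))).add
      (((hasDerivAt_const q (1 : ℝ)).sub (hasDerivAt_id q)).mul (ih φ))
    refine h.congr_deriv ?_
    rw [add_tsub_cancel_right, binE_sub]
    cases m with
    | zero => simp [binE, sub_eq_add_neg]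
    | succ m =>
      simp only [binE, add_tsub_cancel_right, binE_sub, id, Pi.sub_apply]
      push_cast; ring

end Binomial

/-- The number of samples equal to `i` is binomial. -/
theorem integral_count_sampleLaw {k m : ℕ} (p : PMF (Fin k)) (i : Fin k) (φ : ℕ → ℝ) :
    ∫ x, φ (∑ l, if x l = i then 1 else 0) ∂sampleLaw m p = binE m (p i).toReal φ := by
  induction m generalizing φ with
  | zero => simp [binE]
  | succ m ih =>
    have mp := measurePreserving_piFinSuccAbove (fun _ : Fin (m + 1) => p.toMeasure) 0
    have h := mp.integral_comp' fun z : Fin k × (Fin m → Fin k) =>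
      φ ((if z.1 = i then 1 else 0) + ∑ l, if z.2 l = i then 1 else 0)
    rw [integral_prod _ Integrable.of_finite, PMF.integral_eq_sum] at h
    have e : ∀ x : Fin (m + 1) → Fin k,
        (∑ l, if x l = i then 1 else 0) = (if x 0 = i then 1 else 0) +
          ∑ l : Fin m, if x l.succ = i then 1 else 0 := fun x => Fin.sum_univ_succ _
    have h2 : ∫ x, φ (∑ l, if x l = i then 1 else 0) ∂sampleLaw (m + 1) p = ∑ a : Fin k,
        (p a).toReal * ∫ y, φ ((if a = i then 1 else 0) + ∑ l, if y l = i then 1 else 0)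
          ∂sampleLaw m p := by
      simp_rw [e]
      exact h
    rw [h2, binE, ← Finset.add_sum_erase _ _ (Finset.mem_univ i)]
    congr 1
    · rw [← ih]; simp [add_comm]
    · have h3 : ∑ a ∈ Finset.univ.erase i, (p a).toReal = 1 - (p i).toReal := by
        rw [← PMF.sum_toReal_eq_one p, ← Finset.add_sum_erase _ _ (Finset.mem_univ i)]; ring
      rw [← h3, Finset.sum_mul, ← ih]
      refine Finset.sum_congr rfl fun a ha => ?_
      simp [Finset.ne_of_mem_erase ha]

/-! ### Randomly shifted rounding with clipping -/

/-- The count `N`, shifted by the seed `u`, in units of `s`, recentred at `c` and clipped to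
`{0, …, 2 T}`. -/
def quant (s c T N u : ℕ) : ℕ := min (2 * T) ((N + u) / s + T - c)

/-- Expectation of `ψ (quant s c T N u)` for a binomial `N` and a uniform seed `u < s`. -/
noncomputable def quantE (s c T m : ℕ) (q : ℝ) (ψ : ℕ → ℝ) : ℝ :=
  binE m q fun N => (∑ u ∈ Finset.range s, ψ (quant s c T N u)) / s

section Linear

variable (s c T m : ℕ) (q : ℝ)

theorem quantE_add (φ ψ : ℕ → ℝ) :
    quantE s c T m q (fun j => φ j + ψ j) = quantE s c T m q φ + quantE s c T m q ψ := by
  simp only [quantE, Finset.sum_add_distrib, add_div, binE_add]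

theorem quantE_const_mul (a : ℝ) (φ : ℕ → ℝ) :
    quantE s c T m q (fun j => a * φ j) = a * quantE s c T m q φ := by
  simp only [quantE, ← Finset.mul_sum, mul_div_assoc, binE_const_mul]

variable {s}

theorem quantE_const (hs : 1 ≤ s) (a : ℝ) : quantE s c T m q (fun _ => a) = a := by
  have : (s : ℝ) ≠ 0 := by positivity
  simp [quantE, this, binE_const]

theorem quantE_sub_const (hs : 1 ≤ s) (φ : ℕ → ℝ) (a : ℝ) :
    quantE s c T m q (fun j => φ j - a) = quantE s c T m q φ - a := by
  simp only [sub_eq_add_neg, quantE_add, quantE_const _ _ _ _ hs]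

variable {q}

theorem quantE_mono (h0 : 0 ≤ q) (h1 : q ≤ 1) {φ ψ : ℕ → ℝ} (h : ∀ j ≤ 2 * T, φ j ≤ ψ j) :
    quantE s c T m q φ ≤ quantE s c T m q ψ :=
  binE_mono m h0 h1 fun _ => div_le_div_of_nonneg_right
    (Finset.sum_le_sum fun _ _ => h _ (min_le_left _ _)) (Nat.cast_nonneg s)

end Linear

/-! ### Slope of the mean rounded count -/

section Slope

variable {s c T : ℕ} {lam : ℝ}

theorem quant_succ_left (N u : ℕ) : quant s c T (N + 1) u = quant s c T N (u + 1) := by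
  simp only [quant, add_right_comm, add_assoc]

/-- One more sample acts like advancing the seed by one, so the average over seeds telescopes. This
is how the random shift removes the rounding bias: without clipping the difference is exactly 1/s.
-/
theorem sum_quant_succ_sub (N : ℕ) :
    (∑ u ∈ Finset.range s, (quant s c T (N + 1) u : ℝ)) / s -
      (∑ u ∈ Finset.range s, (quant s c T N u : ℝ)) / s =
      ((quant s c T N s : ℝ) - quant s c T N 0) / s := by
  rw [← sub_div, ← Finset.sum_sub_distrib]
  simp only [quant_succ_left]
  rw [Finset.sum_range_sub fun u => (quant s c T N u : ℝ)]

theorem quant_zero_le (N : ℕ) : quant s c T N 0 ≤ quant s c T N s := by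
  unfold quant
  have : (N + 0) / s ≤ (N + s) / s := Nat.div_le_div_right (by omega)
  omega

/-- The increment of the rounded count is `1` unless the count is far from `lam`. -/
theorem one_sub_sq_le_quant_sub (hs : 1 ≤ s) (hT : 2 ≤ T) (hc1 : (c : ℝ) * s ≤ lam)
    (hc2 : lam ≤ (c + 1) * s) (N : ℕ) :
    1 - ((N : ℝ) - lam) ^ 2 / (s * (T - 1)) ^ 2 ≤ (quant s c T N s : ℝ) - quant s c T N 0 := by
  have hs0 : (0 : ℝ) < s := by exact_mod_cast hs
  have hT' : (2 : ℝ) ≤ T := by exact_mod_cast hT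
  have hpos : 0 < (s : ℝ) * (T - 1) := mul_pos hs0 (by linarith)
  have hge : (0 : ℝ) ≤ (quant s c T N s : ℝ) - quant s c T N 0 :=
    sub_nonneg.2 (by exact_mod_cast quant_zero_le N)
  have hdiv : (N + s) / s = N / s + 1 := Nat.add_div_right N hs
  have hlo : ((N / s : ℕ) : ℝ) * s ≤ N := by exact_mod_cast Nat.div_mul_le_self N s
  have hhi : (N : ℝ) ≤ (((N / s : ℕ) : ℝ) + 1) * s := by
    exact_mod_cast (Nat.lt_mul_of_div_lt (Nat.lt_succ_self (N / s)) hs).le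
  -- Under this condition a shift by s raises the value by exactly 1. Otherwise N is at least s(T −
  -- 1) from `lam`, and the left side is nonpositive.
  by_cases h : c ≤ N / s + T ∧ N / s < c + T
  · have : quant s c T N s = quant s c T N 0 + 1 := by
      simp only [quant, hdiv, add_zero]; omega
    rw [this]
    push_cast
    have : 0 ≤ ((N : ℝ) - lam) ^ 2 / (s * (T - 1)) ^ 2 := by positivity
    linarith
  · refine le_trans ?_ hge
    rw [sub_nonpos, one_le_div (by positivity)]
    rcases not_and_or.1 h with h | h
    · have h1 : ((N / s : ℕ) : ℝ) + T + 1 ≤ c := by exact_mod_cast (by omega : N / s + T + 1 ≤ c)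
      have h2 : (((N / s : ℕ) : ℝ) + 1) * s ≤ (c - T) * s := by gcongr; linarith
      rw [← neg_sub lam, neg_sq]
      refine pow_le_pow_left₀ hpos.le ?_ 2
      nlinarith
    · have h1 : (c : ℝ) + T ≤ ((N / s : ℕ) : ℝ) := by exact_mod_cast (by omega : c + T ≤ N / s)
      have h2 : ((c : ℝ) + T) * s ≤ ((N / s : ℕ) : ℝ) * s := by gcongr
      refine pow_le_pow_left₀ hpos.le ?_ 2
      nlinarith

variable {m : ℕ}

theorem hasDerivAt_quantE_id (x : ℝ) :
    HasDerivAt (fun q => quantE s c T m q fun j => (j : ℝ))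
      (m * binE (m - 1) x fun N => ((quant s c T N s : ℝ) - quant s c T N 0) / s) x := by
  refine (hasDerivAt_binE m x _).congr_deriv ?_
  simp only [sum_quant_succ_sub]

theorem deriv_quantE_nonneg {x : ℝ} (h0 : 0 ≤ x) (h1 : x ≤ 1) :
    0 ≤ m * binE (m - 1) x fun N => ((quant s c T N s : ℝ) - quant s c T N 0) / s :=
  mul_nonneg (Nat.cast_nonneg m) <| binE_nonneg _ h0 h1 fun N =>
    div_nonneg (sub_nonneg.2 (by exact_mod_cast quant_zero_le N)) (Nat.cast_nonneg s)

/-- The mean rounded count has slope at least `m / (2 s)` when the mean count is near `lam`. -/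
theorem le_deriv_quantE (hs : 1 ≤ s) (hm : 1 ≤ m) (hT : 16 ≤ T) (hc1 : (c : ℝ) * s ≤ lam)
    (hc2 : lam ≤ (c + 1) * s) (hlam : lam ≤ 4 * s ^ 2) {x : ℝ} (h0 : 0 ≤ x) (h1 : x ≤ 1)
    (hx : |m * x - lam| ≤ s * T / 4) :
    (m : ℝ) / (2 * s) ≤
      m * binE (m - 1) x fun N => ((quant s c T N s : ℝ) - quant s c T N 0) / s := by
  have hs' : (1 : ℝ) ≤ s := by exact_mod_cast hs
  have hT' : (16 : ℝ) ≤ T := by exact_mod_cast hT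
  have hm' : (1 : ℝ) ≤ m := by exact_mod_cast hm
  have hW : 0 < ((s : ℝ) * (T - 1)) ^ 2 := by
    have : 0 < (s : ℝ) * (T - 1) := mul_pos (by linarith) (by linarith)
    positivity
  rw [abs_le] at hx
  have hpoint : ∀ N : ℕ, (1 / (s : ℝ)) * (1 - (((s : ℝ) * (T - 1)) ^ 2)⁻¹ * ((N : ℝ) - lam) ^ 2) ≤
      ((quant s c T N s : ℝ) - quant s c T N 0) / s := fun N => by
    rw [one_div, div_eq_inv_mul ((quant s c T N s : ℝ) - _)]
    refine mul_le_mul_of_nonneg_left ?_ (by positivity)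
    refine le_trans (le_of_eq ?_)
      (one_sub_sq_le_quant_sub (lam := lam) hs (by omega : 2 ≤ T) hc1 hc2 N)
    rw [div_eq_inv_mul]
  have hE := binE_mono (m - 1) h0 h1 hpoint
  rw [binE_const_mul, binE_sub, binE_const, binE_const_mul, binE_sq_sub, Nat.cast_sub hm,
    Nat.cast_one] at hE
  -- Chebyshev in expectation form: variance plus squared bias uses at most half of the squared
  -- window, so half of the slope m/s survives. The extra 1 in the bias comes from m − 1 trials
  -- instead of m.
  have hV : ((m : ℝ) - 1) * x * (1 - x) + ((m - 1) * x - lam) ^ 2 ≤ ((s : ℝ) * (T - 1)) ^ 2 / 2 := by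
    have hA : ((m : ℝ) - 1) * x * (1 - x) ≤ 4 * s ^ 2 + s ^ 2 * (T / 4) := by
      have a1 : ((m : ℝ) - 1) * x * (1 - x) ≤ m * x := by
        nlinarith [mul_nonneg (mul_nonneg (by linarith : (0 : ℝ) ≤ m - 1) h0) h0]
      have a2 : (s : ℝ) * (T / 4) ≤ s ^ 2 * (T / 4) := by
        gcongr; nlinarith
      linarith
    have hB : ((m - 1) * x - lam) ^ 2 ≤ (s * (T / 4 + 1)) ^ 2 := by
      apply sq_le_sq' <;> nlinarith
    have hC : (0 : ℝ) ≤ s ^ 2 * ((T - 1) ^ 2 / 2 - (4 + T / 4 + (T / 4 + 1) ^ 2)) := by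
      apply mul_nonneg (by positivity); nlinarith
    nlinarith
  have hV2 : (((s : ℝ) * (T - 1)) ^ 2)⁻¹ *
      (((m : ℝ) - 1) * x * (1 - x) + ((m - 1) * x - lam) ^ 2) ≤ 1 / 2 := by
    rw [inv_mul_le_iff₀ hW]; linarith
  calc (m : ℝ) / (2 * s) = m * (1 / s * (1 - 1 / 2)) := by field_simp; norm_num
    _ ≤ _ := by
      refine mul_le_mul_of_nonneg_left (le_trans ?_ hE) (by linarith)
      gcongr

/-- A lower bound on the slope of the mean rounded count gives a lower bound on its increments. -/
theorem mul_sub_le_quantE_sub {a b C : ℝ} (hab : a ≤ b)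
    (hC : ∀ x, a ≤ x → x ≤ b →
      C ≤ m * binE (m - 1) x fun N => ((quant s c T N s : ℝ) - quant s c T N 0) / s) :
    C * (b - a) ≤ (quantE s c T m b fun j => (j : ℝ)) - quantE s c T m a fun j => (j : ℝ) := by
  have hd : Differentiable ℝ fun q => quantE s c T m q fun j => (j : ℝ) :=
    fun x => (hasDerivAt_quantE_id x).differentiableAt
  refine (convex_Icc a b).mul_sub_le_image_sub_of_le_deriv hd.continuous.continuousOn
    hd.differentiableOn (fun x hx => ?_) a ⟨le_rfl, hab⟩ b ⟨hab, le_rfl⟩ hab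
  rw [interior_Icc] at hx
  rw [(hasDerivAt_quantE_id x).deriv]
  exact hC x hx.1.le hx.2.le

/-- The mean rounded count separates success probabilities. -/
theorem min_le_abs_quantE_sub (hs : 1 ≤ s) (hm : 1 ≤ m) (hT : 16 ≤ T) (hc1 : (c : ℝ) * s ≤ lam)
    (hc2 : lam ≤ (c + 1) * s) (hlam : lam ≤ 4 * s ^ 2) {q q₀ : ℝ} (hq : 0 ≤ q) (hq1 : q ≤ 1)
    (hq₀ : 0 ≤ q₀) (hq₀1 : q₀ ≤ 1) (h₀ : m * q₀ = lam) :
    min (|m * q - lam| / s) (T / 4) / 2 ≤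
      |(quantE s c T m q fun j => (j : ℝ)) - quantE s c T m q₀ fun j => (j : ℝ)| := by
  have hs0 : (0 : ℝ) < s := by exact_mod_cast hs
  have hm0 : (0 : ℝ) < m := by exact_mod_cast hm
  -- The steep slope is available only within sT/4 of `lam`. It is used over a stretch d/m next to
  -- q₀; on the rest of the way to q monotonicity suffices.
  set d : ℝ := min (|m * q - lam|) (s * T / 4)
  have hd0 : 0 ≤ d := by positivity
  have hd1 : d ≤ |m * q - lam| := min_le_left _ _
  have hd2 : d ≤ s * T / 4 := min_le_right _ _
  have hmin : min (|m * q - lam| / s) (T / 4) = d / s := by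
    rw [← min_div_div_right hs0.le]; congr 1; field_simp
  have hgoal : min (|m * q - lam| / s) (T / 4) / 2 = m / (2 * s) * (d / m) := by
    rw [hmin]; field_simp
  rw [hgoal]
  rcases le_total q₀ q with h | h
  · have habs : |m * q - lam| = m * q - lam := abs_of_nonneg (by rw [← h₀]; nlinarith)
    have hle : q₀ + d / m ≤ q := by
      have : d / m ≤ q - q₀ := by rw [div_le_iff₀ hm0]; rw [habs] at hd1; linarith
      linarith
    have hnn : 0 ≤ d / m := by positivity
    have i1 := mul_sub_le_quantE_sub (s := s) (c := c) (T := T) (m := m) (a := q₀)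
      (b := q₀ + d / m) (by linarith) fun x hx1 hx2 =>
        le_deriv_quantE hs hm hT hc1 hc2 hlam (hq₀.trans hx1) (by linarith) (by
          have e1 : m * q₀ ≤ m * x := by gcongr
          have e2 : m * x ≤ m * (q₀ + d / m) := by gcongr
          rw [mul_add, mul_div_cancel₀ _ hm0.ne'] at e2
          rw [abs_le]; constructor <;> linarith)
    have i2 := mul_sub_le_quantE_sub (s := s) (c := c) (T := T) (m := m) (C := 0) hle
      fun x hx1 hx2 => deriv_quantE_nonneg (by linarith) (by linarith)
    refine le_trans ?_ (le_abs_self _)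
    rw [add_sub_cancel_left] at i1
    linarith
  · have habs : |m * q - lam| = lam - m * q := by
      rw [abs_sub_comm]; exact abs_of_nonneg (by rw [← h₀]; nlinarith)
    have hle : q ≤ q₀ - d / m := by
      have : d / m ≤ q₀ - q := by rw [div_le_iff₀ hm0]; rw [habs] at hd1; linarith
      linarith
    have hnn : 0 ≤ d / m := by positivity
    have i1 := mul_sub_le_quantE_sub (s := s) (c := c) (T := T) (m := m) (a := q₀ - d / m)
      (b := q₀) (by linarith) fun x hx1 hx2 =>
        le_deriv_quantE hs hm hT hc1 hc2 hlam (by linarith) (by linarith) (by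
          have e1 : m * (q₀ - d / m) ≤ m * x := by gcongr
          have e2 : m * x ≤ m * q₀ := by gcongr
          rw [mul_sub, mul_div_cancel₀ _ hm0.ne'] at e1
          rw [abs_le]; constructor <;> linarith)
    have i2 := mul_sub_le_quantE_sub (s := s) (c := c) (T := T) (m := m) (C := 0) hle
      fun x hx1 hx2 => deriv_quantE_nonneg (by linarith) (by linarith)
    rw [abs_sub_comm]
    refine le_trans ?_ (le_abs_self _)
    rw [sub_sub_cancel] at i1
    linarith

end Slope

/-! ### Second moment of the rounded count -/

section SecondMoment

variable {s c T m : ℕ} {lam : ℝ}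

/-- The rounded count is close to the rescaled count. -/
theorem sq_quant_sub_le (hs : 1 ≤ s) (hc1 : (c : ℝ) * s ≤ lam) (hc2 : lam ≤ (c + 1) * s)
    {N u : ℕ} (hu : u < s) :
    ((quant s c T N u : ℝ) - T) ^ 2 ≤ 2 / (s : ℝ) ^ 2 * ((N : ℝ) - lam) ^ 2 + 8 := by
  have hs0 : (0 : ℝ) < s := by exact_mod_cast hs
  set z := (N + u) / s with hz
  have hlo : (z : ℝ) * s ≤ N + u := by exact_mod_cast Nat.div_mul_le_self (N + u) s
  have hhi : (N : ℝ) + u ≤ (z + 1) * s := by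
    exact_mod_cast (Nat.lt_mul_of_div_lt (Nat.lt_succ_self z) hs).le
  have hu' : (u : ℝ) ≤ s := by exact_mod_cast hu.le
  have hu0 : (0 : ℝ) ≤ u := Nat.cast_nonneg u
  set d := ((N : ℝ) - lam) / s with hd
  have hds : d * s = N - lam := by rw [hd]; field_simp
  have hzc1 : (z : ℝ) - c ≤ d + 2 := le_of_mul_le_mul_right (by nlinarith) hs0
  have hzc2 : d - 1 ≤ (z : ℝ) - c := le_of_mul_le_mul_right (by nlinarith) hs0
  -- Clipping to [0, 2T] brings points no farther from the centre T; the lower clip is the truncated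
  -- subtraction in `quant`.
  have h1 : ((quant s c T N u : ℝ) - T) ^ 2 ≤ ((z : ℝ) - c) ^ 2 := by
    have hT0 : (0 : ℝ) ≤ T := Nat.cast_nonneg T
    unfold quant
    rw [← hz]
    rcases le_total (z + T) c with h | h
    · have : min (2 * T) (z + T - c) = 0 := by omega
      rw [this]
      have h' : (z : ℝ) + T ≤ c := by exact_mod_cast h
      push_cast
      nlinarith
    · rcases le_total (2 * T) (z + T - c) with h2 | h2
      · rw [min_eq_left h2]
        have h' : (c : ℝ) + T ≤ z := by exact_mod_cast (by omega : c + T ≤ z)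
        push_cast
        nlinarith
      · rw [min_eq_right h2, Nat.cast_sub h]
        push_cast
        exact le_of_eq (by ring)
  have h2 : 2 / (s : ℝ) ^ 2 * ((N : ℝ) - lam) ^ 2 = 2 * d ^ 2 := by rw [hd]; ring
  rw [h2]
  refine h1.trans ?_
  have : ((z : ℝ) - c) ^ 2 ≤ (|d| + 2) ^ 2 := by
    apply sq_le_sq' <;> linarith [neg_abs_le d, le_abs_self d]
  nlinarith [sq_nonneg (|d| - 2), sq_abs d]

/-- Second moment of the rounded count about the centre of its range. -/
theorem quantE_sq_sub_centre_le (hs : 1 ≤ s) (hc1 : (c : ℝ) * s ≤ lam) (hc2 : lam ≤ (c + 1) * s)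
    (hlam : lam ≤ 4 * s ^ 2) {q : ℝ} (hq : 0 ≤ q) (hq1 : q ≤ 1) :
    quantE s c T m q (fun j => ((j : ℝ) - T) ^ 2) ≤ 17 + 3 * (|m * q - lam| / s) ^ 2 := by
  have hs' : (1 : ℝ) ≤ s := by exact_mod_cast hs
  have hm0 : (0 : ℝ) ≤ m := Nat.cast_nonneg m
  have hpoint : ∀ N : ℕ, (∑ u ∈ Finset.range s, ((quant s c T N u : ℝ) - T) ^ 2) / s ≤
      2 / (s : ℝ) ^ 2 * ((N : ℝ) - lam) ^ 2 + 8 := fun N => by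
    rw [div_le_iff₀ (by linarith), mul_comm]
    refine (Finset.sum_le_card_nsmul _ _ _ fun u hu =>
      sq_quant_sub_le hs hc1 hc2 (Finset.mem_range.1 hu)).trans ?_
    rw [Finset.card_range, nsmul_eq_mul]
  refine (binE_mono m hq hq1 hpoint).trans ?_
  rw [binE_add, binE_const_mul, binE_const, binE_sq_sub]
  set b := |m * q - lam| / s with hb
  have hb0 : 0 ≤ b := by positivity
  have hbs : b * s = |m * q - lam| := by rw [hb]; field_simp
  have hbb : (m * q - lam) ^ 2 = b ^ 2 * s ^ 2 := by rw [← mul_pow, hbs, sq_abs]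
  have h1 : m * q * (1 - q) ≤ 4 * s ^ 2 + b * s ^ 2 := by
    have a1 : m * q * (1 - q) ≤ m * q := by nlinarith [mul_nonneg (mul_nonneg hm0 hq) hq]
    have a2 : m * q ≤ lam + b * s := by rw [hbs]; linarith [le_abs_self (m * q - lam)]
    have a3 : b * s ≤ b * s ^ 2 := by gcongr; nlinarith
    linarith
  calc _ ≤ 2 / (s : ℝ) ^ 2 * (4 * s ^ 2 + b * s ^ 2 + b ^ 2 * s ^ 2) + 8 := by
        rw [hbb]; gcongr
    _ = 2 * (4 + b + b ^ 2) + 8 := by field_simp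
    _ ≤ _ := by nlinarith [sq_nonneg (b - 1)]

/-- The second moment of the rounded count about its mean at `q₀` is controlled by the change of
the mean. -/
theorem quantE_sq_sub_le (hs : 1 ≤ s) (hm : 1 ≤ m) (hT : 16 ≤ T) (hc1 : (c : ℝ) * s ≤ lam)
    (hc2 : lam ≤ (c + 1) * s) (hlam : lam ≤ 4 * s ^ 2) {q q₀ : ℝ} (hq : 0 ≤ q) (hq1 : q ≤ 1)
    (hq₀ : 0 ≤ q₀) (hq₀1 : q₀ ≤ 1) (h₀ : m * q₀ = lam) {μ : ℝ}
    (hμ : quantE s c T m q₀ (fun j => (j : ℝ)) = μ) :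
    quantE s c T m q (fun j => ((j : ℝ) - μ) ^ 2) ≤
      256 * (1 + (quantE s c T m q (fun j => (j : ℝ)) - μ) ^ 2) := by
  have hsep := min_le_abs_quantE_sub hs hm hT hc1 hc2 hlam hq hq1 hq₀ hq₀1 h₀
  rw [hμ] at hsep
  set β := quantE s c T m q (fun j => (j : ℝ)) - μ
  set b := |m * q - lam| / s
  have hb0 : 0 ≤ b := by positivity
  have hT0 : (0 : ℝ) ≤ T := Nat.cast_nonneg T
  -- For small b the separation bound gives b ≤ 2|β|, and the moment about T transfers to μ. For
  -- large b, |β| ≥ T/8, and the trivial bound (2T)² = 256 (T/8)² fixes the constant 256.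
  rcases le_total b (T / 4) with h | h
  · rw [min_eq_left h] at hsep
    have hb : b ^ 2 ≤ 4 * β ^ 2 := by
      rw [← sq_abs β]; nlinarith
    have hμT : (μ - T) ^ 2 ≤ 17 := by
      have h1 := quantE_sq_sub_centre_le (T := T) (m := m) hs hc1 hc2 hlam hq₀ hq₀1
      rw [h₀] at h1
      -- Jensen's inequality, through the tangent line of the square at μ.
      have h2 := quantE_mono (s := s) c T m hq₀ hq₀1
        (φ := fun j => 2 * (μ - T) * ((j : ℝ) - μ) + (μ - T) ^ 2)
        (ψ := fun j => ((j : ℝ) - T) ^ 2) fun j _ => by nlinarith [sq_nonneg ((j : ℝ) - μ)]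
      rw [quantE_add, quantE_const_mul, quantE_sub_const _ _ _ _ hs, hμ,
        quantE_const _ _ _ _ hs] at h2
      simp only [sub_self, abs_zero, zero_div] at h1
      linarith
    have h3 := quantE_mono (s := s) c T m hq hq1
      (φ := fun j => ((j : ℝ) - μ) ^ 2)
      (ψ := fun j => 2 * ((j : ℝ) - T) ^ 2 + 2 * (μ - T) ^ 2)
      fun j _ => by nlinarith [sq_nonneg ((j : ℝ) - T + (μ - T))]
    rw [quantE_add, quantE_const_mul, quantE_const _ _ _ _ hs] at h3
    have h4 := quantE_sq_sub_centre_le (T := T) (m := m) hs hc1 hc2 hlam hq hq1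
    nlinarith [sq_nonneg β]
  · rw [min_eq_right h] at hsep
    have hμ0 : 0 ≤ μ := by
      rw [← hμ, ← quantE_const (s := s) c T m q₀ hs 0]
      exact quantE_mono c T m hq₀ hq₀1 fun j _ => Nat.cast_nonneg j
    have hμ1 : μ ≤ 2 * T := by
      rw [← hμ, ← quantE_const (s := s) c T m q₀ hs (2 * T)]
      exact quantE_mono c T m hq₀ hq₀1 fun j hj => by exact_mod_cast hj
    have h1 := quantE_mono (s := s) c T m hq hq1
      (φ := fun j => ((j : ℝ) - μ) ^ 2) (ψ := fun _ => (2 * T : ℝ) ^ 2) fun j hj => by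
        have hj' : (j : ℝ) ≤ 2 * T := by exact_mod_cast hj
        have hj0 : (0 : ℝ) ≤ j := Nat.cast_nonneg j
        apply sq_le_sq' <;> linarith
    rw [quantE_const _ _ _ _ hs] at h1
    rw [← sq_abs β]
    nlinarith

end SecondMoment

/-! ### Rounded count of a random coordinate, and its kernel -/

/-- The user's message: the coordinate chosen by the seed, and the rounded number of samples equal
to it. -/
def roundedCount (k m s c T : ℕ) (x : Fin m → Fin k) (r : Fin k × Fin s) :
    Fin k × Fin (2 * T + 1) :=
  (r.1, ⟨quant s c T (∑ l, if x l = r.1 then 1 else 0) r.2, Nat.lt_succ_of_le (min_le_left _ _)⟩)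

/-- A message involves only one coordinate, so the binomial marginals suffice and the dependence
between counts plays no role. -/
theorem seededMean_roundedCount {k m s c T : ℕ} (p : PMF (Fin k)) (ψ : Fin k → ℕ → ℝ) :
    seededMean (roundedCount k m s c T) p (fun w => ψ w.1 w.2) =
      (∑ i, quantE s c T m (p i).toReal (ψ i)) / k := by
  have h : ∀ x : Fin m → Fin k,
      (∑ r : Fin k × Fin s, ψ (roundedCount k m s c T x r).1 (roundedCount k m s c T x r).2) /
        (Fintype.card (Fin k × Fin s) : ℝ) =
      (∑ i : Fin k, (∑ u ∈ Finset.range s,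
        ψ i (quant s c T (∑ l, if x l = i then 1 else 0) u)) / s) / k := fun x => by
    rw [Fintype.sum_prod_type, Fintype.card_prod, Fintype.card_fin, Fintype.card_fin,
      ← Finset.sum_div, div_div, Nat.cast_mul, mul_comm (k : ℝ)]
    congr 1
    refine Finset.sum_congr rfl fun i _ => ?_
    rw [← Fin.sum_univ_eq_sum_range fun u =>
      ψ i (quant s c T (∑ l, if x l = i then 1 else 0) u)]
    rfl
  simp only [seededMean, h]
  rw [integral_div, integral_finsetSum _ fun _ _ => Integrable.of_finite]
  congr 1
  refine Finset.sum_congr rfl fun i _ => ?_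
  exact integral_count_sampleLaw p i fun N => (∑ u ∈ Finset.range s, ψ i (quant s c T N u)) / s

/-- The kernel that multiplies the centred rounded counts of users with the same coordinate. -/
noncomputable def coordinateKernel (k T : ℕ) (μ : ℝ) (w w' : Fin k × Fin (2 * T + 1)) : ℝ :=
  if w.1 = w'.1 then (((w.2 : ℕ) : ℝ) - μ) * (((w'.2 : ℕ) : ℝ) - μ) else 0

theorem coordinateKernel_comm {k T : ℕ} (μ : ℝ) (w w' : Fin k × Fin (2 * T + 1)) :
    coordinateKernel k T μ w w' = coordinateKernel k T μ w' w := by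
  simp only [coordinateKernel, eq_comm, mul_comm]

section Moments

variable {k m s c T : ℕ} (p : PMF (Fin k)) (μ : ℝ)

/-- The shift of the mean rounded count of coordinate `i`. -/
noncomputable def meanShift (s c T m : ℕ) (p : PMF (Fin k)) (μ : ℝ) (i : Fin k) : ℝ :=
  (quantE s c T m (p i).toReal fun j => (j : ℝ)) - μ

/-- The second moment of the centred rounded count of coordinate `i`. -/
noncomputable def sqShift (s c T m : ℕ) (p : PMF (Fin k)) (μ : ℝ) (i : Fin k) : ℝ :=
  quantE s c T m (p i).toReal fun j => ((j : ℝ) - μ) ^ 2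

theorem seededMean_coordinateKernel (hs : 1 ≤ s) (w : Fin k × Fin (2 * T + 1)) :
    seededMean (roundedCount k m s c T) p (coordinateKernel k T μ w) =
      (((w.2 : ℕ) : ℝ) - μ) * meanShift s c T m p μ w.1 / k := by
  have h := seededMean_roundedCount (m := m) (s := s) (c := c) (T := T) p fun i (j : ℕ) =>
    (if w.1 = i then ((w.2 : ℕ) : ℝ) - μ else 0) * ((j : ℝ) - μ)
  simp only [quantE_const_mul, quantE_sub_const _ _ _ _ hs] at h
  simp only [ite_mul, zero_mul, Finset.sum_ite_eq, Finset.mem_univ, if_true] at h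
  exact h

theorem seededMean_coordinateKernel_sq (w : Fin k × Fin (2 * T + 1)) :
    seededMean (roundedCount k m s c T) p (fun w' => coordinateKernel k T μ w w' ^ 2) =
      (((w.2 : ℕ) : ℝ) - μ) ^ 2 * sqShift s c T m p μ w.1 / k := by
  have h := seededMean_roundedCount (m := m) (s := s) (c := c) (T := T) p fun i (j : ℕ) =>
    (if w.1 = i then (((w.2 : ℕ) : ℝ) - μ) ^ 2 else 0) * ((j : ℝ) - μ) ^ 2
  simp only [quantE_const_mul] at h
  simp only [ite_mul, zero_mul, Finset.sum_ite_eq, Finset.mem_univ, if_true] at h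
  refine Eq.trans ?_ h
  congr 1
  funext w'
  unfold coordinateKernel
  split_ifs
  · ring
  · ring

/-- The signal: two users both pick i with probability 1/k², and their independent centred reports
then have mean product `meanShift` squared. -/
theorem seededMean_seededMean_coordinateKernel (hs : 1 ≤ s) :
    seededMean (roundedCount k m s c T) p (fun w =>
      seededMean (roundedCount k m s c T) p (coordinateKernel k T μ w)) =
      (∑ i, meanShift s c T m p μ i ^ 2) / k ^ 2 := by
  simp only [seededMean_coordinateKernel p μ hs]
  have h := seededMean_roundedCount (m := m) (s := s) (c := c) (T := T) p fun i (j : ℕ) =>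
    (meanShift s c T m p μ i / k) * ((j : ℝ) - μ)
  simp only [quantE_const_mul, quantE_sub_const _ _ _ _ hs] at h
  calc _ = _ := congrArg _ (funext fun w => by ring)
    _ = _ := h
    _ = _ := by
      rw [Finset.sum_div, Finset.sum_div]
      exact Finset.sum_congr rfl fun i _ => by unfold meanShift; ring

theorem seededMean_seededMean_coordinateKernel_sq :
    seededMean (roundedCount k m s c T) p (fun w =>
      seededMean (roundedCount k m s c T) p fun w' => coordinateKernel k T μ w w' ^ 2) =
      (∑ i, sqShift s c T m p μ i ^ 2) / k ^ 2 := by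
  simp only [seededMean_coordinateKernel_sq p μ]
  have h := seededMean_roundedCount (m := m) (s := s) (c := c) (T := T) p fun i (j : ℕ) =>
    (sqShift s c T m p μ i / k) * ((j : ℝ) - μ) ^ 2
  simp only [quantE_const_mul] at h
  calc _ = _ := congrArg _ (funext fun w => by ring)
    _ = _ := h
    _ = _ := by
      rw [Finset.sum_div, Finset.sum_div]
      exact Finset.sum_congr rfl fun i _ => by unfold sqShift; ring

theorem seededMean_sq_seededMean_coordinateKernel (hs : 1 ≤ s) :
    seededMean (roundedCount k m s c T) p (fun w =>
      seededMean (roundedCount k m s c T) p (coordinateKernel k T μ w) ^ 2) =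
      (∑ i, meanShift s c T m p μ i ^ 2 * sqShift s c T m p μ i) / k ^ 3 := by
  simp only [seededMean_coordinateKernel p μ hs]
  have h := seededMean_roundedCount (m := m) (s := s) (c := c) (T := T) p fun i (j : ℕ) =>
    (meanShift s c T m p μ i / k) ^ 2 * ((j : ℝ) - μ) ^ 2
  simp only [quantE_const_mul] at h
  calc _ = _ := congrArg _ (funext fun w => by ring)
    _ = _ := h
    _ = _ := by
      rw [Finset.sum_div, Finset.sum_div]
      exact Finset.sum_congr rfl fun i _ => by unfold sqShift; ring

end Moments

/-! ### The test for m ≥ k -/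

/-- The resolution `s` and centre `c` at which the counts are rounded. -/
theorem exists_resolution {k m : ℕ} [NeZero k] (hkm : k ≤ m) :
    ∃ s c : ℕ, 1 ≤ s ∧ s ^ 2 * (k : ℝ) ≤ m ∧ (c : ℝ) * s ≤ (m : ℝ) / k ∧
      (m : ℝ) / k ≤ (c + 1) * s ∧ (m : ℝ) / k ≤ 4 * (s : ℝ) ^ 2 := by
  have hk : 0 < k := Nat.pos_of_ne_zero (NeZero.ne k)
  have hk' : (0 : ℝ) < k := by exact_mod_cast hk
  -- This is the fluctuation scale of a count under uniformity; m ≥ k makes it positive, so s + 1 ≤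
  -- 2s, whence the factor 4. Below, c indexes the cell of width s containing m/k.
  set s := Nat.sqrt (m / k) with hs
  have hs1 : 1 ≤ s := Nat.sqrt_pos.2 (Nat.div_pos hkm hk)
  have hs1' : (1 : ℝ) ≤ s := by exact_mod_cast hs1
  set c := m / (k * s) with hc
  refine ⟨s, c, hs1, ?_, ?_, ?_, ?_⟩
  · have h1 : s * s * k ≤ m :=
      (Nat.mul_le_mul_right k (Nat.sqrt_le _)).trans (Nat.div_mul_le_self m k)
    rw [sq]
    exact_mod_cast h1
  · rw [le_div_iff₀ hk']
    have h1 : c * (k * s) ≤ m := Nat.div_mul_le_self m (k * s)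
    have h2 : (c : ℝ) * (k * s) ≤ m := by exact_mod_cast h1
    linarith
  · rw [div_le_iff₀ hk']
    have h1 : m < (c + 1) * (k * s) :=
      Nat.lt_mul_of_div_lt (Nat.lt_succ_self _) (Nat.mul_pos hk hs1)
    have h2 : (m : ℝ) ≤ (c + 1) * (k * s) := by exact_mod_cast h1.le
    linarith
  · rw [div_le_iff₀ hk']
    have h1 : m < ((s + 1) * (s + 1)) * k :=
      Nat.lt_mul_of_div_lt (Nat.lt_succ_sqrt (m / k)) hk
    have h2 : (m : ℝ) ≤ ((s + 1) * (s + 1)) * k := by exact_mod_cast h1.le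
    exact h2.trans (mul_le_mul_of_nonneg_right (by nlinarith) hk'.le)

/-- The sum of squared mean shifts is large when `p` is far from uniform. -/
theorem le_sum_meanShift_sq {k m s c T : ℕ} [NeZero k] {α : ℝ} (hm : 1 ≤ m) (hs : 1 ≤ s)
    (hT : 16 ≤ T) (hsk : s ^ 2 * (k : ℝ) ≤ m) (hc1 : (c : ℝ) * s ≤ (m : ℝ) / k)
    (hc2 : (m : ℝ) / k ≤ (c + 1) * s) (hlam : (m : ℝ) / k ≤ 4 * (s : ℝ) ^ 2) (p : PMF (Fin k))
    (hα : 0 < α) (hp : α < tvDist p (PMF.uniformOfFintype (Fin k))) :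
    min (m * α ^ 2) ((T / 8 : ℝ) ^ 2) ≤
      ∑ i, meanShift s c T m p (quantE s c T m (1 / k) fun j => (j : ℝ)) i ^ 2 := by
  have hk : (1 : ℝ) ≤ k := by exact_mod_cast NeZero.one_le
  have hs' : (1 : ℝ) ≤ s := by exact_mod_cast hs
  have hm' : (1 : ℝ) ≤ m := by exact_mod_cast hm
  set β := meanShift s c T m p (quantE s c T m (1 / k) fun j => (j : ℝ))
  have hβ : ∀ i, min (|m * (p i).toReal - m / k| / s) (T / 4 : ℝ) / 2 ≤ |β i| := fun i =>
    min_le_abs_quantE_sub hs hm hT hc1 hc2 hlam ENNReal.toReal_nonneg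
      (PMF.toReal_apply_le_one p i) (by positivity) (by rw [div_le_one (by linarith)]; exact hk)
      (by ring)
  -- A single saturated coordinate already suffices. If there is none, every shift is in the linear
  -- regime, and the ℓ² bound together with s²k ≤ m gives m α².
  by_cases h : ∃ i, (T / 4 : ℝ) ≤ |m * (p i).toReal - m / k| / s
  · obtain ⟨i, hi⟩ := h
    refine (min_le_right _ _).trans ?_
    have h1 := hβ i
    rw [min_eq_right hi] at h1
    calc (T / 8 : ℝ) ^ 2 ≤ |β i| ^ 2 := pow_le_pow_left₀ (by positivity) (by linarith) 2
      _ = β i ^ 2 := sq_abs _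
      _ ≤ _ := Finset.single_le_sum (f := fun i => β i ^ 2) (fun _ _ => sq_nonneg _)
        (Finset.mem_univ i)
  · push Not at h
    refine (min_le_left _ _).trans ?_
    have hfar := sum_sq_sub_of_lt_tvDist p hα hp
    set D := ∑ x, ((p x).toReal - 1 / (k : ℝ)) ^ 2
    have h1 : ∀ i, (m : ℝ) ^ 2 / (4 * s ^ 2) * ((p i).toReal - 1 / k) ^ 2 ≤ β i ^ 2 := fun i => by
      have h2 := hβ i
      rw [min_eq_left (h i).le] at h2
      calc _ = (|m * (p i).toReal - m / k| / s / 2) ^ 2 := by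
            rw [div_pow, div_pow, sq_abs]; field_simp; ring
        _ ≤ |β i| ^ 2 := pow_le_pow_left₀ (by positivity) h2 2
        _ = _ := sq_abs _
    have h3 : (m : ℝ) ^ 2 / (4 * s ^ 2) * D ≤ ∑ i, β i ^ 2 := by
      rw [Finset.mul_sum]; exact Finset.sum_le_sum fun i _ => h1 i
    refine le_trans ?_ h3
    rw [div_mul_eq_mul_div, le_div_iff₀ (by positivity)]
    refine le_of_mul_le_mul_right ?_ (by linarith : (0 : ℝ) < k)
    calc (m : ℝ) * α ^ 2 * (4 * s ^ 2) * k = m * (4 * α ^ 2) * (s ^ 2 * k) := by ring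
      _ ≤ m * (k * D) * m := by gcongr
      _ = _ := by ring

/-- Sending a rounded count of a random coordinate tests uniformity when `m ≥ k`. -/
theorem exists_testsUniformity_of_le {k m n b : ℕ} [NeZero k] (hkm : k ≤ m)
    (hb : k * (2 * (16 * k) + 1) ≤ 2 ^ b) {α : ℝ} (hα : 0 < α) (hn : 256000 * (k : ℝ) ≤ n)
    (hnα : 256000 * (k * √k) ≤ n * (m * α ^ 2)) :
    ∃ P : SymmetricPrivateCoinProtocol k m n b, P.TestsUniformity α := by
  have hk : (1 : ℝ) ≤ k := by exact_mod_cast NeZero.one_le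
  have hk1 : 1 ≤ k := NeZero.one_le
  have hm : 1 ≤ m := hk1.trans hkm
  obtain ⟨s, c, hs, hsk, hc1, hc2, hlam⟩ := exists_resolution hkm
  -- Large enough that a saturated coordinate gives Q ≥ (T/8)² = 4k², yet the 2T + 1 values still
  -- cost only O(log k) bits.
  set T := 16 * k with hT
  have hT16 : 16 ≤ T := by omega
  set R := √(k : ℝ)
  have hRk : R ^ 2 = k := Real.sq_sqrt (by linarith)
  have hR : 1 ≤ R := Real.one_le_sqrt.2 hk
  have hn2 : 2 ≤ n := by
    have : (2 : ℝ) ≤ n := by linarith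
    exact_mod_cast this
  have hn0 : (0 : ℝ) < n := by linarith
  set μ := quantE s c T m (1 / k) fun j => (j : ℝ) with hμ
  have : Nonempty (Fin s) := ⟨⟨0, hs⟩⟩
  have hM : ∀ (p : PMF (Fin k)) i, sqShift s c T m p μ i ≤ 256 * (1 + meanShift s c T m p μ i ^ 2) :=
    fun p i => quantE_sq_sub_le hs hm hT16 hc1 hc2 hlam ENNReal.toReal_nonneg
      (PMF.toReal_apply_le_one p i) (by positivity) (by rw [div_le_one (by linarith)]; exact hk)
      (by ring) hμ.symm
  have hM0 : ∀ (p : PMF (Fin k)) i, 0 ≤ sqShift s c T m p μ i := fun p i => by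
    have h := quantE_mono (s := s) c T m (q := (p i).toReal) ENNReal.toReal_nonneg
      (PMF.toReal_apply_le_one p i) (φ := fun _ => 0) (ψ := fun j => ((j : ℝ) - μ) ^ 2)
      fun _ _ => sq_nonneg _
    rwa [quantE_const _ _ _ _ hs] at h
  have hunif : ∀ i, meanShift s c T m (PMF.uniformOfFintype (Fin k)) μ i = 0 := fun i => by
    rw [meanShift, toReal_uniformOfFintype_fin, ← hμ, sub_self]
  -- 1536 = 6 · 256, so n²t²/27 = (36/27) · 256²/k exceeds the null second moment bound 256²/k.
  have ht : 0 < 1536 / ((n : ℝ) * R) := by positivity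
  refine exists_testsUniformity_of_kernel (W := Fin k × Fin (2 * T + 1)) (by simpa using hb) hn2 ht
    (roundedCount k m s c T) (coordinateKernel k T μ) (coordinateKernel_comm μ) ?_ ?_ ?_
  · intro w
    rw [seededMean_coordinateKernel _ _ hs, hunif, mul_zero, zero_div]
  · rw [seededMean_seededMean_coordinateKernel_sq]
    have h1 : ∑ i, sqShift s c T m (PMF.uniformOfFintype (Fin k)) μ i ^ 2 ≤ k * 256 ^ 2 := by
      refine (Finset.sum_le_card_nsmul _ _ (256 ^ 2) fun i _ => ?_).trans (by simp)
      have := hM (PMF.uniformOfFintype (Fin k)) i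
      rw [hunif] at this
      exact pow_le_pow_left₀ (hM0 _ i) (by linarith) 2
    calc _ ≤ k * 256 ^ 2 / (k : ℝ) ^ 2 := by gcongr
      _ = 256 ^ 2 / k := by field_simp
      _ ≤ _ := by
        rw [← hRk]
        field_simp
        norm_num
  · intro p hp
    have hQ := le_sum_meanShift_sq hm hs hT16 hsk hc1 hc2 hlam p hα hp
    rw [← hμ] at hQ
    rw [seededMean_seededMean_coordinateKernel _ _ hs, seededMean_seededMean_coordinateKernel_sq,
      seededMean_sq_seededMean_coordinateKernel _ _ hs]
    have hMp := hM p
    have hMp0 := hM0 p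
    set β := meanShift s c T m p μ
    set V := sqShift s c T m p μ
    set Q := ∑ i, β i ^ 2
    have hQ0 : 0 ≤ Q := Finset.sum_nonneg fun _ _ => sq_nonneg _
    have hβQ : ∑ i, β i ^ 2 * β i ^ 2 ≤ Q ^ 2 := by
      rw [sq Q, show Q * Q = ∑ i, Q * β i ^ 2 from Finset.mul_sum _ _ _]
      refine Finset.sum_le_sum fun i _ => mul_le_mul_of_nonneg_right ?_ (sq_nonneg _)
      exact Finset.single_le_sum (f := fun i => β i ^ 2) (fun _ _ => sq_nonneg _)
        (Finset.mem_univ i)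
    have hA : ∑ i, V i ^ 2 ≤ 2 * 256 ^ 2 * (k + Q ^ 2) := by
      calc ∑ i, V i ^ 2 ≤ ∑ i, 2 * 256 ^ 2 * (1 + β i ^ 2 * β i ^ 2) := by
            refine Finset.sum_le_sum fun i _ => ?_
            have := pow_le_pow_left₀ (hMp0 i) (hMp i) 2
            nlinarith [sq_nonneg (β i ^ 2 - 1)]
        _ = 2 * 256 ^ 2 * (k + ∑ i, β i ^ 2 * β i ^ 2) := by
            rw [← Finset.mul_sum, Finset.sum_add_distrib]; simp
        _ ≤ _ := by gcongr
    have hB : ∑ i, β i ^ 2 * V i ≤ 256 * (Q + Q ^ 2) := by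
      calc ∑ i, β i ^ 2 * V i ≤ ∑ i, 256 * (β i ^ 2 + β i ^ 2 * β i ^ 2) := by
            refine Finset.sum_le_sum fun i _ => ?_
            have := mul_le_mul_of_nonneg_left (hMp i) (sq_nonneg (β i))
            linarith
        _ = 256 * (Q + ∑ i, β i ^ 2 * β i ^ 2) := by
            rw [← Finset.mul_sum, Finset.sum_add_distrib]
        _ ≤ _ := by gcongr
    have hRR : R ≤ k := by rw [← hRk]; nlinarith
    have hX : 256000 * (k * R) ≤ n * Q := by
      rcases min_le_iff.1 hQ with h | h
      · exact hnα.trans (by gcongr)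
      · have hTk : (T : ℝ) / 8 = 2 * k := by rw [hT]; push_cast; ring
        rw [hTk] at h
        calc 256000 * (k * R) ≤ 256000 * (k * (2 * k) ^ 2) := by gcongr; nlinarith
          _ = 256000 * k * (2 * k) ^ 2 := by ring
          _ ≤ _ := by gcongr
    refine ⟨?_, ?_⟩
    · rw [← mul_div_assoc, div_le_div_iff₀ (by positivity) (by positivity)]
      calc 2 * 1536 * (k : ℝ) ^ 2 = 3072 * (k * R) * R := by rw [← hRk]; ring
        _ ≤ 256000 * (k * R) * R := by gcongr; norm_num
        _ ≤ n * Q * R := by gcongr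
        _ = _ := by ring
    · have hkR : k ≤ k * R := le_mul_of_one_le_right (by linarith) hR
      -- Once multiplied by k⁴, the variance bound has terms in k³, k²Q², nkQ and nkQ²; `b1` to `b4`
      -- absorb them in this order.
      have b1 : (256000 * (k * R)) ^ 2 ≤ (n * Q) ^ 2 := by gcongr
      have b1' : (k * R) ^ 2 = (k : ℝ) ^ 3 := by rw [mul_pow, hRk]; ring
      have b2 : (256000 * (k : ℝ) * Q) ^ 2 ≤ (n * Q) ^ 2 := by gcongr
      have b3 : 256000 * (k : ℝ) * (n * Q) ≤ (n * Q) * (n * Q) :=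
        mul_le_mul_of_nonneg_right (by linarith) (by positivity)
      have b4 : (n * Q) * (256000 * (k : ℝ) * Q) ≤ (n * Q) * (n * Q) := by gcongr
      rw [mul_pow, b1'] at b1
      have total : 2 * 256 ^ 2 * (k + Q ^ 2) * (k : ℝ) ^ 2 + n * (256 * (Q + Q ^ 2)) * k ≤
          (n * Q) ^ 2 / 108 := by
        have b5 : 0 ≤ (n * Q) ^ 2 := sq_nonneg _
        ring_nf at b1 b2 b3 b4 b5 ⊢; linarith
      calc _ ≤ 2 * 256 ^ 2 * (k + Q ^ 2) / (k : ℝ) ^ 2 + n * (256 * (Q + Q ^ 2) / (k : ℝ) ^ 3) := by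
            gcongr
        _ = (2 * 256 ^ 2 * (k + Q ^ 2) * (k : ℝ) ^ 2 + n * (256 * (Q + Q ^ 2)) * k) / k ^ 4 := by
            field_simp
        _ ≤ (n * Q) ^ 2 / 108 / k ^ 4 := by gcongr
        _ = _ := by field_simp

/-! ### The trivial domain and the choice of constants -/

/-- With at most one element in the domain, the server always accepts. -/
theorem exists_testsUniformity_fin_one {m n : ℕ} {α : ℝ} (hα : 0 < α) :
    ∃ P : SymmetricPrivateCoinProtocol 1 m n 0, P.TestsUniformity α := by
  set P := SymmetricPrivateCoinProtocol.ofSeed n (fun (_ : Fin m → Fin 1) (_ : Unit) => ())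
    (fun _ => (Fin.elim0 : Fin 0 → Bool)) fun _ => true
  have hP : ∀ y, P.decision y = true := fun _ => rfl
  refine ⟨P, fun p => ⟨fun _ => ?_, fun h => ?_⟩⟩
  · unfold SymmetricPrivateCoinProtocol.transcriptLaw
    simp only [hP, Set.ofPred_true, probReal_univ]
    norm_num
  · have h1 := PMF.sum_toReal_eq_one p
    have h2 := PMF.sum_toReal_eq_one (PMF.uniformOfFintype (Fin 1))
    rw [Fin.sum_univ_one] at h1 h2
    have : tvDist p (PMF.uniformOfFintype (Fin 1)) = 0 := by
      rw [tvDist, Fin.sum_univ_one, h1, h2]; simp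
    linarith

theorem mainTheorem2 :
    ∃ C : ℝ, 0 < C ∧ ∃ B : ℝ, 0 < B ∧
      ∀ (k : ℕ) [NeZero k] (m : ℕ) (α : ℝ) (n : ℕ), 1 ≤ m → 0 < α → α ≤ 1 →
        C * max ((k : ℝ) ^ (3 / 2 : ℝ) * Real.log k / (m * α ^ 2)) k ≤ n →
        ∃ b : ℕ, (b : ℝ) ≤ B * Real.log k ∧
          ∃ P : SymmetricPrivateCoinProtocol k m n b, P.TestsUniformity α := by
  refine ⟨512000, by norm_num, 40, by norm_num, fun k _ m α n hm hα _ hn => ?_⟩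
  have hk1 : 1 ≤ k := NeZero.one_le
  obtain rfl | hk2 := hk1.eq_or_lt
  -- Since log 1 = 0, no bits are allowed here.
  · exact ⟨0, by simp, exists_testsUniformity_fin_one hα⟩
  have hk : (2 : ℝ) ≤ k := by exact_mod_cast hk2
  have hm' : (1 : ℝ) ≤ m := by exact_mod_cast hm
  have hlog2 : (1 / 2 : ℝ) ≤ Real.log 2 := by linarith [Real.log_two_gt_d9]
  have hlogk : Real.log 2 ≤ Real.log k := Real.log_le_log (by norm_num) hk
  have hn1 : 512000 * (k : ℝ) ≤ n := le_trans (by gcongr; exact le_max_right _ _) hn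
  have hpow : (k : ℝ) ^ (3 / 2 : ℝ) = k * √k := by
    rw [Real.sqrt_eq_rpow, show (3 / 2 : ℝ) = 1 + 1 / 2 by norm_num,
      Real.rpow_add (by linarith), Real.rpow_one]
  -- The logarithm enters only through log k ≥ 1/2, which halves 512000.
  have hn2 : 256000 * (k * √k) ≤ n * (m * α ^ 2) := by
    have h1 : 512000 * ((k : ℝ) * √k * Real.log k / (m * α ^ 2)) ≤ n := by
      rw [← hpow]
      exact le_trans (by gcongr; exact le_max_left _ _) hn
    rw [← mul_div_assoc, div_le_iff₀ (by positivity)] at h1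
    refine le_trans ?_ h1
    have h2 : 0 ≤ (k : ℝ) * √k := by positivity
    nlinarith
  set l := Nat.log 2 k with hl
  have hl1 : 1 ≤ l := Nat.log_pos (by norm_num) hk2
  have hlk : 2 ^ l ≤ k := Nat.pow_log_le_self 2 (by omega)
  have hkl : k + 1 ≤ 2 ^ (l + 1) := Nat.lt_pow_succ_log_self (by norm_num) k
  have hbits : (k + 1) ^ 10 ≤ 2 ^ (10 * (l + 1)) := by
    rw [mul_comm, pow_mul]; exact Nat.pow_le_pow_left hkl 10
  -- As l ≥ 1 and log 2 ≥ 1/2, 10(l + 1) ≤ 20 l ≤ 40 log k. The exponent 10 leaves ample room for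
  -- k(32k + 1) messages.
  refine ⟨10 * (l + 1), ?_, ?_⟩
  · have h1 : l * Real.log 2 ≤ Real.log k := by
      rw [← Real.log_pow]
      exact Real.log_le_log (by positivity) (by exact_mod_cast hlk)
    have h2 : (1 : ℝ) ≤ l := by exact_mod_cast hl1
    push_cast
    nlinarith
  · rcases le_total k m with hkm | hkm
    · refine exists_testsUniformity_of_le hkm (le_trans ?_ hbits) hα (by linarith) hn2
      have h1 : 33 ≤ (k + 1) ^ 8 :=
        (by norm_num : 33 ≤ 3 ^ 8).trans (Nat.pow_le_pow_left (by omega) 8)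
      calc k * (2 * (16 * k) + 1) ≤ 33 * (k + 1) ^ 2 := by nlinarith
        _ ≤ (k + 1) ^ 8 * (k + 1) ^ 2 := Nat.mul_le_mul_right _ h1
        _ = _ := (pow_add _ _ _).symm
    · refine exists_testsUniformity_of_one_sample hm (le_trans ?_ hbits) hα (by linarith) ?_
      · exact (Nat.le_succ k).trans (Nat.le_self_pow (by norm_num) _)
      · have hmk : (m : ℝ) ≤ k := by exact_mod_cast hkm
        refine le_of_mul_le_mul_left ?_ (by linarith : (0 : ℝ) < k)
        calc k * (1000 * √(k : ℝ)) = 1000 * (k * √k) := by ring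
          _ ≤ 256000 * (k * √k) := by gcongr; norm_num
          _ ≤ n * (m * α ^ 2) := hn2
          _ ≤ n * (k * α ^ 2) := by gcongr
          _ = _ := by ring
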